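/- Let $k\ge 2$, $d\ge 2$, $n_0\ge 1$ and $n$ be integers. A (finite) hypergraph $\mathcal G=(V,E)$ consists of a finite vertex set $V$ and a set $E$ of non-empty subsets of $V$ (edges); it is $k$-uniform if every edge has exactly $k$ vertices. The degree $d(v)$ of a vertex is the number of edges containing it. A path of length $p$ is a sequence $(u_1,e_1,u_2,\dots,e_p,u_{p+1})$ of distinct vertices $u_i$ and distinct edges $e_i$ with $u_i,u_{i+1}\in e_i$ for all $i$; a cycle is such a sequence with $p\ge 2$ in which $u_1,\dots,u_p$ are distinct, $e_1,\dots,e_p$ are distinct and $u_{p+1}=u_1$. The distance $\mathrm{dist}(u,v)$ is the length of a shortest path from $u$ to $v$. A supertree is a connected hypergraph without cycles. Its boundary $\partial V$ is the set of vertices of degree $1$, and $V^\circ=V\setminus\partial V$ is the set of interior vertices. The Laplacian of $\mathcal G$ is $L_{\mathcal G}=D-A$, where $D$ is the diagonal matrix of the degrees and $A_{ij}=\sum_{e\in E,\ \{i,j\}\subseteq e}\frac1{|e|-1}$ for $i\ne j$, $A_{ii}=0$. A real number $\lambda$ is a Dirichlet eigenvalue of $\mathcal G$ if there is a function $f\neq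 0$ on $V$ with $L_{\mathcal G}f(u)=\lambda f(u)$ for $u\in V^\circ$ and $f(u)=0$ for $u\in\partial V$; the smallest one is the first Dirichlet eigenvalue $\lambda(\mathcal G)$. Let $\mathcal T^{n,n_0}$ be the class of $k$-uniform supertrees with $|V|=n$ and $|V^\circ|=n_0$, and let $\mathcal T^{n,n_0}_d$ be the class of those with $d(v)\ge d$ for all $v\in V^\circ$. A supertree has the Faber–Krahn property within $\mathcal T^{n,n_0}_d$ if it belongs to this class and its first Dirichlet eigenvalue is minimal in this class. For a supertree with root $v_0$ put $h(v)=\mathrm{dist}(v,v_0)$; a vertex $v$ is the parent of $u$ if $u,v$ are distinct, lie in a common edge and $h(u)=h(v)+1$. A well-ordering $\prec$ of the vertices is an SLO-ordering (spiral-like ordering) if (S1) $u\prec v$ implies $h(u)\le h(v)$; (S2) if $u$ is the parent of $u_1$, $v$ is the parent of $v_1$ and $u\prec v$, then $u_1\prec v_1$; (S3) if $u\prec v$ and $u\in\partial V$, then $v\in\partial V$; (S4) if $e=\{u_1,\dots,u_k\}$ is an edge with $u_1\prec\dots\prec u_k$, there is no vertex $v\notin e$ with $u_i\prec v\prec u_{i+1}$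 for some $2\le i\le k-1$; (S5) for $u,v\in V^\circ$, $u\prec v$ implies $d(u)\le d(v)$. A supertree is an SLO-supertree if it has an SLO-ordering for some choice of the root. Theorem. A supertree $\mathcal G\in\mathcal T^{n,n_0}$ has the Faber–Krahn property within the class $\mathcal T_d^{n,n_0}$ if and only if it is an SLO-supertree in which at most one interior vertex has degree greater than $d$, while all other interior vertices have degree $d$. If $\mathcal T_d^{n,n_0}$ is not empty, a supertree with the Faber–Krahn property within this class exists, and it is unique up to isomorphism. -/

import Mathlib

/-- A finite hypergraph on the vertex set `V`: a set of non-empty subsets of `V`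
(no multiple edges). -/
@[ext]
structure FinHypergraph (V : Type*) where
  /-- The edges. -/
  edges : Finset (Finset V)
  /-- Every edge is non-empty. -/
  nonempty_of_mem : ∀ e ∈ edges, e.Nonempty

namespace FinHypergraph

section Basic

variable {V : Type*}

/-- Every edge has exactly `k` vertices. -/
def IsUniform (G : FinHypergraph V) (k : ℕ) : Prop :=
  ∀ e ∈ G.edges, e.card = k

/-- Two distinct vertices are adjacent if they share an edge. -/
def Adj (G : FinHypergraph V) (u v : V) : Prop :=
  u ≠ v ∧ ∃ e ∈ G.edges, u ∈ e ∧ v ∈ e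

/-- `(u 0, e 0, u 1, e 1, …, e (p-1), u p)` is an alternating sequence of vertices and edges,
with `u i, u (i+1) ∈ e i` for every `i`. -/
def IsAlternating (G : FinHypergraph V) (p : ℕ) (u : Fin (p + 1) → V) (e : Fin p → Finset V) :
    Prop :=
  ∀ i : Fin p, e i ∈ G.edges ∧ u i.castSucc ∈ e i ∧ u i.succ ∈ e i

/-- A path of length `p`: the vertices are distinct and the edges are distinct. -/
def IsPath (G : FinHypergraph V) (p : ℕ) (u : Fin (p + 1) → V) (e : Fin p → Finset V) : Prop :=
  G.IsAlternating p u e ∧ Function.Injective u ∧ Function.Injective e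

/-- A cycle of length `p ≥ 2`: the edges are distinct, and the vertices are distinct except that
the last one is equal to the first one. -/
def IsCycle (G : FinHypergraph V) (p : ℕ) (u : Fin (p + 1) → V) (e : Fin p → Finset V) : Prop :=
  2 ≤ p ∧ G.IsAlternating p u e ∧ u 0 = u (Fin.last p) ∧
    Function.Injective (fun i : Fin p => u i.castSucc) ∧ Function.Injective e

/-- There is a path of length `p` from `a` to `b`. -/
def HasPath (G : FinHypergraph V) (a b : V) (p : ℕ) : Prop :=
  ∃ (u : Fin (p + 1) → V) (e : Fin p → Finset V),
    G.IsPath p u e ∧ u 0 = a ∧ u (Fin.last p) = b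

/-- Any two vertices are joined by a path. -/
def IsConnected (G : FinHypergraph V) : Prop :=
  Nonempty V ∧ ∀ a b : V, ∃ p, G.HasPath a b p

/-- There is no cycle. -/
def IsAcyclic (G : FinHypergraph V) : Prop :=
  ∀ (p : ℕ) (u : Fin (p + 1) → V) (e : Fin p → Finset V), ¬ G.IsCycle p u e

/-- A supertree is a connected and acyclic hypergraph. -/
def IsSupertree (G : FinHypergraph V) : Prop :=
  G.IsConnected ∧ G.IsAcyclic

/-- The distance of two vertices: the length of a shortest path that connects them. -/
noncomputable def dist (G : FinHypergraph V) (a b : V) : ℕ :=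
  sInf {p | G.HasPath a b p}

/-- Two hypergraphs are isomorphic if a bijection of the vertices carries edges to edges and
non-edges to non-edges. -/
def Isomorphic {W : Type*} (G : FinHypergraph V) (H : FinHypergraph W) : Prop :=
  ∃ σ : V ≃ W, ∀ e : Finset V, e.map σ.toEmbedding ∈ H.edges ↔ e ∈ G.edges

end Basic

section Degree

variable {V : Type*} [DecidableEq V]

/-- The degree of a vertex: the number of edges that contain it. -/
def degree (G : FinHypergraph V) (v : V) : ℕ :=
  (G.edges.filter fun e => v ∈ e).card

/-- The boundary vertices are the vertices of degree one. -/
def IsBoundary (G : FinHypergraph V) (v : V) : Prop :=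
  G.degree v = 1

/-- The interior vertices are the other ones. -/
def IsInterior (G : FinHypergraph V) (v : V) : Prop :=
  ¬ G.IsBoundary v

instance (G : FinHypergraph V) : DecidablePred G.IsBoundary :=
  fun v => inferInstanceAs (Decidable (G.degree v = 1))

instance (G : FinHypergraph V) : DecidablePred G.IsInterior :=
  fun v => inferInstanceAs (Decidable (¬ G.IsBoundary v))

end Degree

section Spectral

variable {V : Type*} [Fintype V] [DecidableEq V]

/-- The adjacency matrix; its entry at two distinct vertices `i`, `j` is the sum of
`1 / (|e| - 1)` over the edges `e` that contain both (zero if there are none), and its diagonal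
is zero. -/
noncomputable def adjMatrix (G : FinHypergraph V) : Matrix V V ℝ :=
  Matrix.of fun i j =>
    if i = j then 0
    else ∑ e ∈ G.edges.filter (fun e => i ∈ e ∧ j ∈ e), 1 / ((e.card : ℝ) - 1)

/-- The Laplacian matrix: the diagonal matrix of the degrees minus the adjacency matrix. -/
noncomputable def lapMatrix (G : FinHypergraph V) : Matrix V V ℝ :=
  Matrix.diagonal (fun v => (G.degree v : ℝ)) - G.adjMatrix

/-- `c` is a Dirichlet eigenvalue: some non-zero function `f` vanishes on the boundary and
satisfies `L f = c f` at the interior vertices. -/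
def IsDirichletEigenvalue (G : FinHypergraph V) (c : ℝ) : Prop :=
  ∃ f : V → ℝ, f ≠ 0 ∧
    (∀ v, G.IsInterior v → G.lapMatrix.mulVec f v = c * f v) ∧
    (∀ v, G.IsBoundary v → f v = 0)

/-- The first (smallest) Dirichlet eigenvalue. The Dirichlet eigenvalues form a finite set, which
is non-empty when there is an interior vertex, so that the infimum is then a minimum. -/
noncomputable def firstDirichletEigenvalue (G : FinHypergraph V) : ℝ :=
  sInf {c : ℝ | G.IsDirichletEigenvalue c}

/-- `G` has the Faber–Krahn property within the class `C`: it belongs to `C` and its first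
Dirichlet eigenvalue is minimal in `C`. -/
def HasFaberKrahn (C : Set (FinHypergraph V)) (G : FinHypergraph V) : Prop :=
  G ∈ C ∧ ∀ H ∈ C, G.firstDirichletEigenvalue ≤ H.firstDirichletEigenvalue

end Spectral

section SpiralLike

variable {V : Type*}

/-- In the supertree `G` with root `r`, the vertex `p` is the parent of `c` (and `c` a child of
`p`): they are adjacent and the height of `c` is one more than the height of `p`, where the height
of a vertex is its distance from the root. -/
def IsParent (G : FinHypergraph V) (r p c : V) : Prop :=
  G.Adj p c ∧ G.dist c r = G.dist p r + 1

/-- `lt` is a spiral-like ordering of the vertices of `G` with root `r`. -/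
structure IsSLOrdering [DecidableEq V] (G : FinHypergraph V) (r : V) (lt : V → V → Prop) :
    Prop where
  /-- `lt` is a well-ordering. -/
  wellOrder : IsWellOrder V lt
  /-- Heights are non-decreasing. -/
  height_le : ∀ u v, lt u v → G.dist u r ≤ G.dist v r
  /-- Children are ordered as their parents are. -/
  children : ∀ u v u₁ v₁, G.IsParent r u u₁ → G.IsParent r v v₁ → lt u v → lt u₁ v₁
  /-- Boundary vertices come after the interior vertices. -/
  boundary : ∀ u v, lt u v → G.IsBoundary u → G.IsBoundary v
  /-- The vertices of an edge, without the first one, are consecutive: no vertex outside of the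
  edge `e` lies between two vertices `b`, `c` of `e` that are not the first vertex of `e`. -/
  edge_consecutive : ∀ e ∈ G.edges, ∀ a ∈ e, ∀ b ∈ e, ∀ c ∈ e, lt a b → lt b c →
    ¬ ∃ v, v ∉ e ∧ lt b v ∧ lt v c
  /-- The degrees of the interior vertices are non-decreasing. -/
  degree_le : ∀ u v, G.IsInterior u → G.IsInterior v → lt u v → G.degree u ≤ G.degree v

/-- A hypergraph whose vertices have a spiral-like ordering for some choice of the root. -/
def HasSLOrdering [DecidableEq V] (G : FinHypergraph V) : Prop :=
  ∃ (r : V) (lt : V → V → Prop), G.IsSLOrdering r lt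

/-- At most one interior vertex has degree greater than `d`, and every other interior vertex has
degree `d`. -/
def AtMostOneInteriorDegreeGT [Fintype V] [DecidableEq V] (G : FinHypergraph V) (d : ℕ) : Prop :=
  (Finset.univ.filter fun v => G.IsInterior v ∧ d < G.degree v).card ≤ 1 ∧
    ∀ v, G.IsInterior v → ¬ d < G.degree v → G.degree v = d

end SpiralLike

/-- The `k`-uniform supertrees with `n` vertices and `n₀` interior vertices. -/
def supertrees (k n n₀ : ℕ) : Set (FinHypergraph (Fin n)) :=
  {G | G.IsUniform k ∧ G.IsSupertree ∧ (Finset.univ.filter fun v => G.IsInterior v).card = n₀}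

/-- The `k`-uniform supertrees with `n` vertices and `n₀` interior vertices all of whose interior
vertices have degree at least `d`. -/
def supertreesMinDegree (k n n₀ d : ℕ) : Set (FinHypergraph (Fin n)) :=
  {G | G ∈ supertrees k n n₀ ∧ ∀ v, G.IsInterior v → d ≤ G.degree v}

end FinHypergraph

/-! The class is finite, so a minimizer exists. What has to be shown is that every minimizer has a
spiral-like ordering with the prescribed degrees, and that such supertrees are unique up to
isomorphism. The first eigenvalue is an isomorphism invariant, so the converse follows: a spiral
supertree is isomorphic to some minimizer.

Let `f` be the positive ground state of a minimizer. By uniformity the Dirichlet form, multiplied by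
`k - 1`, is the sum over the edges of `k ∑ f² - (∑ f)²`, so altering one or two edges changes only a
few terms. A surgery that keeps the boundary and stays in the class cannot lower the form at `f`. If
it leaves the form unchanged, then `f` is an eigenfunction of the new supertree too, and the two
Laplacians of `f` agree at interior vertices (`IsExtremal.scaledLap_eq`); this rigidity decides the
ties. Only connectivity of the new hypergraph has to be checked, since acyclicity comes from
counting (`IsSupertree.of_reachable`).

Two surgeries suffice. Exchanging members of two edges (`IsExtremal.swap`) shows that, when two
edges are joined by a path leaving them at gates, the edge with the larger gate value has the larger
values elsewhere. Rooted at a maximum of `f`, the tree then has `f` non-increasing in the height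
(`IsExtremal.le_of_h_lt`) and along a numbering by parent, then edge sum, then value
(`IsExtremal.exists_code`). Moving an edge to another vertex (`IsExtremal.shift`) shows that only
the last interior vertex can have degree above `d` (`IsExtremal.degree_eq_of_lt`).

For uniqueness, the vertices after the root come in blocks of `k - 1`, one block per edge, and the
degrees tell which position is the parent of which block. Hence positions determine the edges
(`IsSpiralPosition`). -/

namespace FinHypergraph

/-! ### Reachability, paths and cycles through a simple graph -/

section Link

variable {V : Type*}

/-- The graph in which two distinct vertices are adjacent if some member of `F` contains both. -/
def link (F : Finset (Finset V)) : SimpleGraph V where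
  Adj x y := x ≠ y ∧ ∃ e ∈ F, x ∈ e ∧ y ∈ e
  symm := ⟨fun _ _ ⟨h, e, he, hx, hy⟩ => ⟨h.symm, e, he, hy, hx⟩⟩
  loopless := ⟨fun _ h => h.1 rfl⟩

theorem reachable_of_mem {F : Finset (Finset V)} {e : Finset V} (he : e ∈ F) {x y : V}
    (hx : x ∈ e) (hy : y ∈ e) : (link F).Reachable x y := by
  by_cases h : x = y
  · subst h; rfl
  · exact SimpleGraph.Adj.reachable ⟨h, e, he, hx, hy⟩

theorem reachable_of_forall {F F' : Finset (Finset V)}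
    (h : ∀ e ∈ F, ∀ x ∈ e, ∀ y ∈ e, (link F').Reachable x y) {x y : V}
    (hxy : (link F).Reachable x y) : (link F').Reachable x y := by
  obtain ⟨w⟩ := hxy
  induction w with
  | nil => rfl
  | cons hadj _ ih =>
    obtain ⟨-, e, he, hx, hy⟩ := hadj
    exact (h e he _ hx _ hy).trans ih

theorem reachable_mono {F F' : Finset (Finset V)} (h : F ⊆ F') {x y : V}
    (hxy : (link F).Reachable x y) : (link F').Reachable x y :=
  reachable_of_forall (fun _ he _ hx _ hy => reachable_of_mem (h he) hx hy) hxy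

theorem link_dist_le_one {F : Finset (Finset V)} {e : Finset V} (he : e ∈ F) {x y : V}
    (hx : x ∈ e) (hy : y ∈ e) : (link F).dist x y ≤ 1 := by
  by_cases h : x = y
  · subst h; simp
  · exact (SimpleGraph.dist_eq_one_iff_adj.2 (⟨h, e, he, hx, hy⟩ : (link F).Adj x y)).le

theorem link_dist_le_succ {F : Finset (Finset V)} {e : Finset V} (he : e ∈ F) {x y z : V}
    (hx : x ∈ e) (hy : y ∈ e) : (link F).dist x z ≤ (link F).dist y z + 1 := by
  have hxy := reachable_of_mem he hx hy
  have h1 := link_dist_le_one he hx hy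
  by_cases hr : (link F).Reachable y z
  · have := hxy.dist_triangle_left z
    omega
  · rw [SimpleGraph.dist_eq_zero_of_not_reachable (fun h => hr (hxy.symm.trans h))]
    omega

theorem exists_mem_dist_lt {F : Finset (Finset V)} {x z : V} (h : (link F).Reachable x z)
    (hne : x ≠ z) : ∃ e ∈ F, x ∈ e ∧ ∃ y ∈ e, (link F).dist x z = (link F).dist y z + 1 := by
  obtain ⟨w, hw⟩ := h.exists_walk_length_eq_dist
  cases w with
  | nil => exact absurd rfl hne
  | cons hadj w =>
    simp only [SimpleGraph.Walk.length_cons] at hw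
    obtain ⟨-, e, he, hx, hy⟩ := hadj
    refine ⟨e, he, hx, _, hy, ?_⟩
    have h1 := SimpleGraph.dist_le w
    have h2 := link_dist_le_succ (z := z) he hx hy
    omega

theorem exists_geodesic {F : Finset (Finset V)} {b : V} (p : ℕ) : ∀ a : V,
    (link F).Reachable a b → (link F).dist a b = p →
    ∃ (u : Fin (p + 1) → V) (e : Fin p → Finset V),
      (∀ i : Fin p, e i ∈ F ∧ u i.castSucc ∈ e i ∧ u i.succ ∈ e i) ∧
      u 0 = a ∧ u (Fin.last p) = b ∧ ∀ i, (link F).dist (u i) b + i = p := by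
  induction p with
  | zero =>
    intro a hr h0
    have : a = b := (hr.dist_eq_zero_iff).1 h0
    refine ⟨fun _ => a, Fin.elim0, fun i => i.elim0, rfl, this, fun i => ?_⟩
    simp [h0]
  | succ p ih =>
    intro a hr hp
    have hne : a ≠ b := by rintro rfl; simp at hp
    obtain ⟨e₀, he₀, ha, y, hy, hd⟩ := exists_mem_dist_lt hr hne
    obtain ⟨u, e, h1, h2, h3, h4⟩ := ih y ((reachable_of_mem he₀ hy ha).trans hr) (by omega)
    refine ⟨Fin.cons a u, Fin.cons e₀ e, ?_, rfl, ?_, ?_⟩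
    · intro i
      refine Fin.cases ?_ (fun j => ?_) i
      · refine ⟨he₀, ha, ?_⟩
        simpa [h2] using hy
      · simpa [← Fin.succ_castSucc] using h1 j
    · rw [← Fin.succ_last]; simpa using h3
    · intro i
      refine Fin.cases ?_ (fun j => ?_) i
      · simpa using hp
      · have := h4 j
        simp only [Fin.cons_succ, Fin.val_succ]
        omega

/-- Along a geodesic the distance to `b` drops by one at each step, so the vertices are distinct. An
edge used twice would contain two vertices whose distances to `b` differ by at least two. -/
theorem exists_path {F : Finset (Finset V)} {a b : V} (h : (link F).Reachable a b) :
    ∃ (u : Fin ((link F).dist a b + 1) → V) (e : Fin ((link F).dist a b) → Finset V),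
      (∀ i, e i ∈ F ∧ u i.castSucc ∈ e i ∧ u i.succ ∈ e i) ∧
      u 0 = a ∧ u (Fin.last _) = b ∧ Function.Injective u ∧ Function.Injective e := by
  obtain ⟨u, e, h1, h2, h3, h4⟩ := exists_geodesic _ a h rfl
  refine ⟨u, e, h1, h2, h3, fun i j hij => ?_, ?_⟩
  · have := h4 i
    have := h4 j
    rw [hij] at *
    omega
  · have key : ∀ i j, i < j → e i ≠ e j := by
      intro i j hlt hij
      have hi := h1 i
      have hj := h1 j
      have := link_dist_le_succ (z := b) hi.1 hi.2.1 (hij ▸ hj.2.2)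
      have a1 := h4 i.castSucc
      have a2 := h4 j.succ
      simp only [Fin.val_castSucc, Fin.val_succ] at a1 a2
      have : (i : ℕ) < j := hlt
      omega
    intro i j hij
    rcases lt_trichotomy i j with h | h | h
    · exact absurd hij (key i j h)
    · exact h
    · exact absurd hij.symm (key j i h)

theorem reachable_of_alternating {F : Finset (Finset V)} {p : ℕ} {u : Fin (p + 1) → V}
    {e : Fin p → Finset V}
    (h : ∀ i : Fin p, e i ∈ F ∧ u i.castSucc ∈ e i ∧ u i.succ ∈ e i) (i : Fin (p + 1)) :
    (link F).Reachable (u 0) (u i) ∧ (link F).dist (u 0) (u i) ≤ i := by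
  induction i using Fin.induction with
  | zero => simp
  | succ j ih =>
    obtain ⟨he, h1, h2⟩ := h j
    refine ⟨ih.1.trans (reachable_of_mem he h1 h2), ?_⟩
    have := link_dist_le_succ (z := u 0) he h2 h1
    rw [SimpleGraph.dist_comm, Fin.val_succ]
    rw [SimpleGraph.dist_comm] at ih
    simp only [Fin.val_castSucc] at ih
    omega

theorem hasPath_of_reachable {G : FinHypergraph V} {a b : V}
    (h : (link G.edges).Reachable a b) : G.HasPath a b ((link G.edges).dist a b) := by
  obtain ⟨u, e, h1, h2, h3, h4, h5⟩ := exists_path h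
  exact ⟨u, e, ⟨h1, h4, h5⟩, h2, h3⟩

theorem HasPath.reachable {G : FinHypergraph V} {a b : V} {p : ℕ} (h : G.HasPath a b p) :
    (link G.edges).Reachable a b ∧ (link G.edges).dist a b ≤ p := by
  obtain ⟨u, e, ⟨h1, -, -⟩, rfl, rfl⟩ := h
  simpa using reachable_of_alternating h1 (Fin.last p)

theorem IsConnected.reachable {G : FinHypergraph V} (h : G.IsConnected) (a b : V) :
    (link G.edges).Reachable a b := by
  obtain ⟨p, hp⟩ := h.2 a b
  exact hp.reachable.1

theorem isConnected_of_reachable {G : FinHypergraph V} [Nonempty V]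
    (h : ∀ a b, (link G.edges).Reachable a b) : G.IsConnected :=
  ⟨‹_›, fun a b => ⟨_, hasPath_of_reachable (h a b)⟩⟩

theorem IsConnected.dist_eq {G : FinHypergraph V} (h : G.IsConnected) (a b : V) :
    G.dist a b = (link G.edges).dist a b := by
  apply le_antisymm
  · exact Nat.sInf_le (hasPath_of_reachable (h.reachable a b))
  · exact (Nat.sInf_mem (s := {p | G.HasPath a b p})
      ⟨_, hasPath_of_reachable (h.reachable a b)⟩ : G.HasPath a b _).reachable.2

variable [DecidableEq V]

/-- A geodesic that avoids `e` is closed to a cycle by `e`. Together with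
`isAcyclic_of_not_reachable` this turns acyclicity into a statement about reachability alone. -/
theorem IsAcyclic.not_reachable {G : FinHypergraph V} (h : G.IsAcyclic) {e : Finset V}
    (he : e ∈ G.edges) {x y : V} (hx : x ∈ e) (hy : y ∈ e) (hxy : x ≠ y) :
    ¬ (link (G.edges.erase e)).Reachable x y := by
  intro hr
  have hpos := hr.pos_dist_of_ne hxy
  have hpath := exists_path hr
  generalize (link (G.edges.erase e)).dist x y = p at hpos hpath
  obtain ⟨u, c, h1, h2, h3, h4, h5⟩ := hpath
  refine h (p + 1) (Fin.snoc u x : Fin (p + 1 + 1) → V) (Fin.snoc c e : Fin (p + 1) → Finset V)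
    ⟨by omega, ?_, ?_, ?_, ?_⟩
  · intro i
    refine Fin.lastCases ?_ (fun j => ?_) i
    · refine ⟨by simpa using he, ?_, ?_⟩
      · simpa [h3] using hy
      · simpa using hx
    · have := h1 j
      simp only [Fin.snoc_castSucc, Fin.succ_castSucc]
      exact ⟨Finset.mem_of_mem_erase this.1, this.2⟩
  · rw [show (0 : Fin (p + 1 + 1)) = Fin.castSucc 0 from rfl, Fin.snoc_castSucc, Fin.snoc_last, h2]
  · intro i j hij
    simpa using h4 (by simpa using hij)
  · intro i j
    refine Fin.lastCases ?_ (fun i' => ?_) i <;> refine Fin.lastCases ?_ (fun j' => ?_) j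
    · simp
    · intro hij
      simp only [Fin.snoc_castSucc, Fin.snoc_last] at hij
      exact absurd hij (Finset.ne_of_mem_erase (h1 j').1).symm
    · intro hij
      simp only [Fin.snoc_castSucc, Fin.snoc_last] at hij
      exact absurd hij (Finset.ne_of_mem_erase (h1 i').1)
    · intro hij
      simp only [Fin.snoc_castSucc] at hij
      rw [h5 hij]

theorem isAcyclic_of_not_reachable {G : FinHypergraph V}
    (h : ∀ e ∈ G.edges, ∀ x ∈ e, ∀ y ∈ e, x ≠ y → ¬ (link (G.edges.erase e)).Reachable x y) :
    G.IsAcyclic := by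
  rintro p u e ⟨hp, halt, hclosed, hu, he⟩
  obtain ⟨q, rfl⟩ : ∃ q, p = q + 1 := ⟨p - 1, by omega⟩
  have h0 := halt 0
  have hr : ∀ i : Fin (q + 1), (link (G.edges.erase (e 0))).Reachable (u 1) (u i.succ) := by
    intro i
    induction i using Fin.induction with
    | zero => exact SimpleGraph.Reachable.refl _
    | succ j ih =>
      have hj := halt j.succ
      have hne : e j.succ ≠ e 0 := fun hh => Fin.succ_ne_zero j (he hh)
      refine ih.trans (reachable_of_mem (Finset.mem_erase.2 ⟨hne, hj.1⟩) ?_ hj.2.2)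
      rw [Fin.succ_castSucc]
      exact hj.2.1
  refine h _ h0.1 (u 0) (by simpa using h0.2.1) (u 1) (by simpa using h0.2.2) ?_ ?_
  · intro hh
    have h01 : (0 : Fin (q + 1)) = ⟨1, by omega⟩ := hu (by
      simpa [Fin.ext_iff] using hh)
    simp [Fin.ext_iff] at h01
  · rw [hclosed, ← Fin.succ_last]
    exact (hr (Fin.last q)).symm

end Link

/-! ### Edge counts of connected and of cyclic hypergraphs -/

section Count

variable {V : Type*} [Fintype V] [DecidableEq V]

/-- Charge each vertex other than `r` to an edge that leads towards `r`. The member of an edge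
nearest to `r` is not charged to it, so `e` receives at most `e.card - 1` charges. -/
theorem card_le_of_reachable {F : Finset (Finset V)} (r : V)
    (h : ∀ v, (link F).Reachable v r) : Fintype.card V ≤ 1 + ∑ e ∈ F, (e.card - 1) := by
  have hex : ∀ v, ∃ e, v ≠ r → e ∈ F ∧ v ∈ e ∧
      ∃ y ∈ e, (link F).dist v r = (link F).dist y r + 1 := by
    intro v
    by_cases hv : v = r
    · exact ⟨∅, fun h => absurd hv h⟩
    · obtain ⟨e, h1, h2⟩ := exists_mem_dist_lt (h v) hv
      exact ⟨e, fun _ => ⟨h1, h2⟩⟩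
  choose pe hpe using hex
  have hmaps : ∀ v ∈ (Finset.univ.erase r : Finset V), pe v ∈ F :=
    fun v hv => (hpe v (Finset.ne_of_mem_erase hv)).1
  have hcard := Finset.card_eq_sum_card_fiberwise hmaps
  have hle : ∑ e ∈ F, ((Finset.univ.erase r).filter fun v => pe v = e).card ≤
      ∑ e ∈ F, (e.card - 1) := by
    refine Finset.sum_le_sum fun e he => ?_
    rcases e.eq_empty_or_nonempty with rfl | hne
    · simp only [Finset.card_empty, Nat.zero_sub, Nat.le_zero, Finset.card_eq_zero]
      rw [Finset.filter_eq_empty_iff]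
      intro v hv hve
      have := (hpe v (Finset.ne_of_mem_erase hv)).2.1
      rw [hve] at this
      simp at this
    · obtain ⟨b, hb, hmin⟩ := e.exists_min_image (fun v => (link F).dist v r) hne
      rw [← Finset.card_erase_of_mem hb]
      refine Finset.card_le_card fun v hv => ?_
      rw [Finset.mem_filter] at hv
      obtain ⟨hv, rfl⟩ := hv
      obtain ⟨-, h2, y, hy, hd⟩ := hpe v (Finset.ne_of_mem_erase hv)
      refine Finset.mem_erase.2 ⟨?_, h2⟩
      rintro rfl
      have := hmin y hy
      omega
  rw [Finset.card_erase_of_mem (Finset.mem_univ r), Finset.card_univ] at hcard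
  omega

/-- Since `x` stays connected to `y` without `e`, it can be deleted from `e` without losing
connectivity. The bound for the smaller edge gains one. -/
theorem card_lt_of_cyclic {F : Finset (Finset V)} (r : V)
    (h : ∀ v, (link F).Reachable v r) {e : Finset V} (he : e ∈ F) {x y : V} (hx : x ∈ e)
    (hy : y ∈ e) (hxy : x ≠ y) (hr : (link (F.erase e)).Reachable x y) :
    Fintype.card V < 1 + ∑ e ∈ F, (e.card - 1) := by
  have hsub : F.erase e ⊆ insert (e.erase x) (F.erase e) := Finset.subset_insert _ _
  have hxr := reachable_mono hsub hr
  have key : ∀ w ∈ e, (link (insert (e.erase x) (F.erase e))).Reachable y w := by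
    intro w hw
    by_cases hwx : w = x
    · subst hwx; exact hxr.symm
    · exact reachable_of_mem (Finset.mem_insert_self _ _)
        (Finset.mem_erase.2 ⟨hxy.symm, hy⟩) (Finset.mem_erase.2 ⟨hwx, hw⟩)
  have hall : ∀ v, (link (insert (e.erase x) (F.erase e))).Reachable v r := by
    intro v
    refine reachable_of_forall (fun e' he' a ha b hb => ?_) (h v)
    by_cases hee : e' = e
    · subst hee
      exact (key a ha).symm.trans (key b hb)
    · exact reachable_of_mem (hsub (Finset.mem_erase.2 ⟨hee, he'⟩)) ha hb
  have h1 := card_le_of_reachable r hall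
  have h2 : ∑ e' ∈ insert (e.erase x) (F.erase e), (e'.card - 1) ≤
      ((e.erase x).card - 1) + ∑ e' ∈ F.erase e, (e'.card - 1) := by
    -- The shrunken edge may already be present; merging the two only lowers the sum.
    by_cases hin : e.erase x ∈ F.erase e
    · rw [Finset.insert_eq_of_mem hin]; omega
    · rw [Finset.sum_insert hin]
  have h3 := Finset.add_sum_erase F (fun e' => e'.card - 1) he
  have h4 : 1 < e.card := Finset.one_lt_card.2 ⟨x, hx, y, hy, hxy⟩
  rw [Finset.card_erase_of_mem hx] at h2
  omega

end Count

/-! ### Rooted structure of a supertree -/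

section Rooted

variable {V : Type*}

/-- The structure of a supertree with root `r`: the height `h`, the vertex `top e` of smallest
height of an edge, and the unique edge `pe v` that leads from `v` towards the root. -/
structure Rooted (G : FinHypergraph V) (r : V) (h : V → ℕ) (top : Finset V → V)
    (pe : V → Finset V) : Prop where
  h_eq : ∀ v, h v = G.dist v r
  h_eq_zero : ∀ v, h v = 0 ↔ v = r
  top_mem : ∀ e ∈ G.edges, top e ∈ e
  h_of_mem : ∀ e ∈ G.edges, ∀ v ∈ e, v ≠ top e → h v = h (top e) + 1
  pe_mem : ∀ v, v ≠ r → pe v ∈ G.edges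
  mem_pe : ∀ v, v ≠ r → v ∈ pe v
  ne_top : ∀ v, v ≠ r → v ≠ top (pe v)
  eq_pe : ∀ e ∈ G.edges, ∀ v ∈ e, v ≠ top e → v ≠ r ∧ e = pe v

/-- Each edge of a geodesic to the root has a member strictly nearer to the root than `v`. This is
used to see that certain edges are avoided. -/
theorem reachable_root {F : Finset (Finset V)} {r : V} (hF : ∀ v, (link F).Reachable v r) (v : V) :
    (link (F.filter fun e => ∃ w ∈ e, (link F).dist w r < (link F).dist v r)).Reachable v r := by
  induction hm : (link F).dist v r generalizing v with
  | zero => rw [(hF v).dist_eq_zero_iff.1 hm]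
  | succ m ih =>
    have hne : v ≠ r := by rintro rfl; simp at hm
    obtain ⟨e, he, hv, y, hy, hd⟩ := exists_mem_dist_lt (hF v) hne
    refine (reachable_of_mem (e := e) (Finset.mem_filter.2 ⟨he, y, hy, by omega⟩) hv hy).trans ?_
    refine reachable_mono ?_ (ih y (by omega))
    intro e' he'
    rw [Finset.mem_filter] at he' ⊢
    obtain ⟨h1, w, hw, h2⟩ := he'
    exact ⟨h1, w, hw, by omega⟩

/-- Two members of an edge at its least height would both reach the root without that edge, against
acyclicity. Two different edges leading upwards from one vertex are excluded in the same way. -/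
theorem IsSupertree.exists_rooted [DecidableEq V] {G : FinHypergraph V} (hG : G.IsSupertree) (r : V) :
    ∃ h top pe, G.Rooted r h top pe := by
  classical
  obtain ⟨hc, ha⟩ := hG
  have hF : ∀ v, (link G.edges).Reachable v r := fun v => hc.reachable v r
  set h : V → ℕ := fun v => (link G.edges).dist v r with hh
  have hlow : ∀ e ∈ G.edges, ∀ v, (∀ w ∈ e, h v ≤ h w) →
      (link (G.edges.erase e)).Reachable v r := by
    intro e he v hv
    refine reachable_mono (fun e' he' => ?_) (reachable_root hF v)
    obtain ⟨h1, w, hw, h2⟩ := Finset.mem_filter.1 he'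
    refine Finset.mem_erase.2 ⟨?_, h1⟩
    rintro rfl
    exact absurd (hv w hw) (not_le.2 h2)
  have hex : ∀ e, ∃ t, e ∈ G.edges → t ∈ e ∧ ∀ w ∈ e, h t ≤ h w := by
    intro e
    by_cases he : e ∈ G.edges
    · obtain ⟨t, ht, h1⟩ := e.exists_min_image h (G.nonempty_of_mem e he)
      exact ⟨t, fun _ => ⟨ht, h1⟩⟩
    · exact ⟨r, fun h => absurd h he⟩
  choose top htop using hex
  have hmem : ∀ e ∈ G.edges, ∀ v ∈ e, v ≠ top e → h v = h (top e) + 1 := by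
    intro e he v hv hne
    obtain ⟨h1, h2⟩ := htop e he
    have h3 := link_dist_le_succ (z := r) he hv h1
    have h4 := h2 v hv
    rcases Nat.lt_or_ge (h (top e)) (h v) with h5 | h5
    · simp only [hh] at *; omega
    · exfalso
      refine ha.not_reachable he hv h1 hne ?_
      exact (hlow e he v (fun w hw => h5.trans (h2 w hw))).trans (hlow e he _ h2).symm
  have hne_r : ∀ e ∈ G.edges, ∀ v ∈ e, v ≠ top e → v ≠ r := by
    rintro e he v hv hne rfl
    have := hmem e he v hv hne
    simp [hh] at this
  have huniq : ∀ e ∈ G.edges, ∀ e' ∈ G.edges, ∀ v ∈ e, v ∈ e' → v ≠ top e → v ≠ top e' →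
      e = e' := by
    intro e he e' he' v hv hv' hne hne'
    by_contra hee
    have h1 := hmem e he v hv hne
    have h2 := hmem e' he' v hv' hne'
    refine ha.not_reachable he hv (htop e he).1 hne ?_
    have h3 : (link (G.edges.erase e)).Reachable v (top e') :=
      reachable_of_mem (Finset.mem_erase.2 ⟨Ne.symm hee, he'⟩) hv' (htop e' he').1
    refine (h3.trans (hlow e he _ fun w hw => ?_)).trans (hlow e he _ (htop e he).2).symm
    have := (htop e he).2 w hw
    omega
  -- The value of `pe` at the root is a dummy; nothing is claimed about it.
  have hexpe : ∀ v, ∃ e, v ≠ r → e ∈ G.edges ∧ v ∈ e ∧ v ≠ top e := by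
    intro v
    by_cases hv : v = r
    · exact ⟨∅, fun h => absurd hv h⟩
    · obtain ⟨e, he, h1, y, hy, h2⟩ := exists_mem_dist_lt (hF v) hv
      refine ⟨e, fun _ => ⟨he, h1, ?_⟩⟩
      intro heq
      have := (htop e he).2 y hy
      rw [← heq] at this
      simp only [hh] at this
      omega
  choose pe hpe using hexpe
  refine ⟨h, top, pe, fun v => (hc.dist_eq v r).symm, fun v => (hF v).dist_eq_zero_iff,
    fun e he => (htop e he).1, hmem, fun v hv => (hpe v hv).1, fun v hv => (hpe v hv).2.1,
    fun v hv => (hpe v hv).2.2, fun e he v hv hne => ?_⟩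
  have hvr := hne_r e he v hv hne
  exact ⟨hvr, huniq e he _ (hpe v hvr).1 v hv (hpe v hvr).2.1 hne (hpe v hvr).2.2⟩

namespace Rooted

variable {G : FinHypergraph V} {r : V} {h : V → ℕ} {top : Finset V → V} {pe : V → Finset V}

theorem top_le (R : G.Rooted r h top pe) {e : Finset V} (he : e ∈ G.edges) {v : V} (hv : v ∈ e) :
    h (top e) ≤ h v := by
  by_cases hne : v = top e
  · rw [hne]
  · rw [R.h_of_mem e he v hv hne]; omega

theorem h_pe (R : G.Rooted r h top pe) {v : V} (hv : v ≠ r) : h v = h (top (pe v)) + 1 :=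
  R.h_of_mem _ (R.pe_mem v hv) v (R.mem_pe v hv) (R.ne_top v hv)

theorem eq_top_of_ne (R : G.Rooted r h top pe) {e : Finset V} (he : e ∈ G.edges) {v : V}
    (hv : v ∈ e) (hne : e ≠ pe v) : v = top e := by
  by_contra hh
  exact hne (R.eq_pe e he v hv hh).2

theorem top_pe_mem (R : G.Rooted r h top pe) {v : V} (hv : v ≠ r) : top (pe v) ∈ pe v :=
  R.top_mem _ (R.pe_mem v hv)

/-- Every vertex is joined to the root by edges that start at smaller heights. -/
theorem reachable_root (R : G.Rooted r h top pe) (v : V) :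
    (link (G.edges.filter fun e => h (top e) < h v)).Reachable v r := by
  induction hm : h v generalizing v with
  | zero => rw [(R.h_eq_zero v).1 hm]
  | succ m ih =>
    have hne : v ≠ r := by
      intro hv; rw [(R.h_eq_zero v).2 hv] at hm; omega
    have h1 := R.h_pe hne
    refine (reachable_of_mem (Finset.mem_filter.2 ⟨R.pe_mem v hne, by omega⟩)
      (R.mem_pe v hne) (R.top_pe_mem hne)).trans ?_
    refine reachable_mono ?_ (ih (top (pe v)) (by omega))
    intro e he
    rw [Finset.mem_filter] at he ⊢
    exact ⟨he.1, by omega⟩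

theorem isParent_iff (R : G.Rooted r h top pe) {p c : V} :
    G.IsParent r p c ↔ c ≠ r ∧ p = top (pe c) := by
  constructor
  · rintro ⟨⟨hne, e, he, hp, hc⟩, hd⟩
    rw [← R.h_eq, ← R.h_eq] at hd
    have hct : c ≠ top e := by
      rintro rfl
      have := R.top_le he hp
      omega
    obtain ⟨h1, rfl⟩ := R.eq_pe e he c hc hct
    refine ⟨h1, ?_⟩
    by_contra hpt
    have h2 := R.h_of_mem _ he p hp hpt
    have h3 := R.h_pe h1
    omega
  · rintro ⟨hc, rfl⟩
    refine ⟨⟨(R.ne_top c hc).symm, pe c, R.pe_mem c hc, R.top_pe_mem hc, R.mem_pe c hc⟩, ?_⟩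
    rw [← R.h_eq, ← R.h_eq]
    exact R.h_pe hc

variable [Fintype V] [DecidableEq V]

theorem filter_pe_eq (R : G.Rooted r h top pe) {e : Finset V} (he : e ∈ G.edges) :
    (Finset.univ.erase r).filter (fun v => pe v = e) = e.erase (top e) := by
  ext v
  simp only [Finset.mem_filter, Finset.mem_erase, Finset.mem_univ, and_true]
  constructor
  · rintro ⟨hv, rfl⟩
    exact ⟨R.ne_top v hv, R.mem_pe v hv⟩
  · rintro ⟨h1, h2⟩
    obtain ⟨h3, h4⟩ := R.eq_pe e he v h2 h1
    exact ⟨h3, h4.symm⟩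

theorem card_eq (R : G.Rooted r h top pe) {k : ℕ} (hk : G.IsUniform k) :
    Fintype.card V = 1 + G.edges.card * (k - 1) := by
  have hcard := Finset.card_eq_sum_card_fiberwise (s := Finset.univ.erase r) (t := G.edges)
    (f := pe) (fun v hv => R.pe_mem v (Finset.ne_of_mem_erase hv))
  rw [Finset.sum_congr rfl (fun e he => by
    rw [R.filter_pe_eq he, Finset.card_erase_of_mem (R.top_mem e he), hk e he]),
    Finset.sum_const, smul_eq_mul, Finset.card_erase_of_mem (Finset.mem_univ r),
    Finset.card_univ] at hcard
  have : 0 < Fintype.card V := Fintype.card_pos_iff.2 ⟨r⟩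
  omega

end Rooted

end Rooted

/-! ### Criterion for a modified hypergraph to be a supertree -/

section Surgery

variable {V : Type*} [DecidableEq V]

/-- A common vertex different from `x₁` would be joined to `x₁` without `e₁`, through `e₂` and the
given connection; the same holds with the indices exchanged. -/
theorem IsAcyclic.inter_subset {G : FinHypergraph V} (h : G.IsAcyclic) {e₁ e₂ : Finset V}
    (h₁ : e₁ ∈ G.edges) (h₂ : e₂ ∈ G.edges) (hne : e₁ ≠ e₂) {x₁ x₂ : V} (hx₁ : x₁ ∈ e₁)
    (hx₂ : x₂ ∈ e₂) (hr : (link ((G.edges.erase e₁).erase e₂)).Reachable x₁ x₂) {c : V}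
    (hc₁ : c ∈ e₁) (hc₂ : c ∈ e₂) : c = x₁ ∧ c = x₂ := by
  have hr' : (link ((G.edges.erase e₂).erase e₁)).Reachable x₁ x₂ := by
    rwa [Finset.erase_right_comm]
  constructor
  · by_contra hc
    refine h.not_reachable h₁ hc₁ hx₁ hc ?_
    refine SimpleGraph.Reachable.trans (reachable_of_mem
      (Finset.mem_erase.2 ⟨hne.symm, h₂⟩) hc₂ hx₂) ?_
    exact (reachable_mono (Finset.erase_subset _ _) hr).symm
  · by_contra hc
    refine h.not_reachable h₂ hc₂ hx₂ hc ?_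
    refine SimpleGraph.Reachable.trans (reachable_of_mem
      (Finset.mem_erase.2 ⟨hne, h₁⟩) hc₁ hx₁) ?_
    exact reachable_mono (Finset.erase_subset _ _) hr'

variable [Fintype V]

theorem IsSupertree.card_eq {G : FinHypergraph V} (hG : G.IsSupertree) {k : ℕ}
    (hk : G.IsUniform k) : Fintype.card V = 1 + G.edges.card * (k - 1) := by
  obtain ⟨r⟩ := hG.1.1
  obtain ⟨h, top, pe, R⟩ := hG.exists_rooted r
  exact R.card_eq hk

/-- A connected uniform hypergraph with no more edges than a supertree on the same vertices is
a supertree. -/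
theorem IsSupertree.of_reachable {G H : FinHypergraph V} (hG : G.IsSupertree) {k : ℕ} (hk : 2 ≤ k)
    (hGk : G.IsUniform k) (hHk : H.IsUniform k) (hle : H.edges.card ≤ G.edges.card)
    (hr : ∀ e ∈ G.edges, ∀ x ∈ e, ∀ y ∈ e, (link H.edges).Reachable x y) :
    H.IsSupertree ∧ H.edges.card = G.edges.card := by
  have hcon : ∀ a b, (link H.edges).Reachable a b :=
    fun a b => reachable_of_forall hr (hG.1.reachable a b)
  obtain ⟨r⟩ := hG.1.1
  have : Nonempty V := ⟨r⟩
  have hsum : ∑ e ∈ H.edges, (e.card - 1) = H.edges.card * (k - 1) := by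
    rw [Finset.sum_congr rfl (fun e he => by rw [hHk e he]), Finset.sum_const, smul_eq_mul]
  have h1 := card_le_of_reachable r (fun v => hcon v r)
  have h2 := hG.card_eq hGk
  have hmul := Nat.mul_le_mul_right (k - 1) hle
  have hcard : H.edges.card = G.edges.card := by
    refine le_antisymm hle ?_
    have : G.edges.card * (k - 1) ≤ H.edges.card * (k - 1) := by omega
    exact Nat.le_of_mul_le_mul_right this (by omega)
  -- The bound of `card_le_of_reachable` is attained, whereas a cycle would make it strict.
  refine ⟨⟨isConnected_of_reachable hcon, isAcyclic_of_not_reachable ?_⟩, hcard⟩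
  intro e he x hx y hy hxy hre
  have := card_lt_of_cyclic r (fun v => hcon v r) he hx hy hxy hre
  rw [hsum, hcard] at this
  omega

end Surgery

/-! ### The Dirichlet form and the scaled Laplacian -/

section Energy

variable {V : Type*}

/-- The Dirichlet form of a `k`-uniform hypergraph, multiplied by `k - 1`. -/
def energy (G : FinHypergraph V) (k : ℕ) (f : V → ℝ) : ℝ :=
  ∑ e ∈ G.edges, (k * ∑ v ∈ e, f v ^ 2 - (∑ v ∈ e, f v) ^ 2)

theorem energy_smul (G : FinHypergraph V) (k : ℕ) (t : ℝ) (f : V → ℝ) :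
    G.energy k (t • f) = t ^ 2 * G.energy k f := by
  rw [energy, energy, Finset.mul_sum]
  refine Finset.sum_congr rfl fun e _ => ?_
  simp only [Pi.smul_apply, smul_eq_mul, mul_pow, ← Finset.mul_sum]
  ring

theorem energy_abs_le (G : FinHypergraph V) (k : ℕ) (f : V → ℝ) :
    G.energy k (fun v => |f v|) ≤ G.energy k f := by
  refine Finset.sum_le_sum fun e _ => ?_
  have h1 : |∑ v ∈ e, f v| ≤ ∑ v ∈ e, |f v| := Finset.abs_sum_le_sum_abs _ _
  have h2 : (∑ v ∈ e, f v) ^ 2 ≤ (∑ v ∈ e, |f v|) ^ 2 := by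
    rw [← sq_abs (∑ v ∈ e, f v)]
    exact pow_le_pow_left₀ (abs_nonneg _) h1 2
  simp only [sq_abs]
  linarith

theorem energy_continuous (G : FinHypergraph V) (k : ℕ) : Continuous (G.energy k) := by
  unfold energy
  fun_prop

variable [DecidableEq V]

theorem isInterior_of_two_edges {G : FinHypergraph V} {v : V} {e₁ e₂ : Finset V}
    (h₁ : e₁ ∈ G.edges) (h₂ : e₂ ∈ G.edges) (hv₁ : v ∈ e₁) (hv₂ : v ∈ e₂) (hne : e₁ ≠ e₂) :
    G.IsInterior v := by
  intro hb
  obtain ⟨e, he⟩ := Finset.card_eq_one.1 (hb : (G.edges.filter fun e => v ∈ e).card = 1)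
  have m₁ : e₁ ∈ ({e} : Finset (Finset V)) := he ▸ Finset.mem_filter.2 ⟨h₁, hv₁⟩
  have m₂ : e₂ ∈ ({e} : Finset (Finset V)) := he ▸ Finset.mem_filter.2 ⟨h₂, hv₂⟩
  rw [Finset.mem_singleton] at m₁ m₂
  exact hne (m₁.trans m₂.symm)

/-- The Laplacian of a `k`-uniform hypergraph, multiplied by `k - 1`. -/
def scaledLap (G : FinHypergraph V) (k : ℕ) (f : V → ℝ) (v : V) : ℝ :=
  ∑ e ∈ G.edges with v ∈ e, (k * f v - ∑ w ∈ e, f w)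

/-- A non-negative Dirichlet eigenfunction that vanishes at an interior vertex is zero. -/
theorem eq_zero_of_eigen {G : FinHypergraph V} {k : ℕ} {c : ℝ} {f : V → ℝ}
    (hcon : G.IsConnected) (hf0 : ∀ v, 0 ≤ f v) (hf : ∀ v, G.IsBoundary v → f v = 0)
    (h : ∀ v, G.IsInterior v → G.scaledLap k f v = c * f v) {a : V} (ha : G.IsInterior a)
    (ha0 : f a = 0) : f = 0 := by
  have step : ∀ v, G.IsInterior v → f v = 0 → ∀ e ∈ G.edges, v ∈ e → ∀ w ∈ e, f w = 0 := by
    intro v hv hv0 e he hve w hw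
    have h1 := h v hv
    rw [scaledLap, hv0] at h1
    simp only [mul_zero, zero_sub, Finset.sum_neg_distrib, neg_eq_zero] at h1
    have h2 := (Finset.sum_eq_zero_iff_of_nonneg fun e' _ =>
      Finset.sum_nonneg fun w _ => hf0 w).1 h1 e (Finset.mem_filter.2 ⟨he, hve⟩)
    exact (Finset.sum_eq_zero_iff_of_nonneg fun w _ => hf0 w).1 h2 w hw
  funext b
  by_cases hb : G.IsBoundary b
  · exact hf b hb
  obtain ⟨p, u, e, ⟨halt, -, hinj⟩, rfl, rfl⟩ := hcon.2 a b
  -- Every vertex of the path except the last is interior, because an inner vertex lies in two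
  -- distinct edges; so the vanishing can be passed on.
  have key : ∀ i : Fin (p + 1), f (u i) = 0 ∧ (∀ j : Fin p, j.castSucc = i → G.IsInterior (u i)) := by
    intro i
    induction i using Fin.induction with
    | zero => exact ⟨ha0, fun _ _ => ha⟩
    | succ j ih =>
      obtain ⟨h1, h2, h3⟩ := halt j
      refine ⟨step _ (ih.2 j rfl) ih.1 _ h1 h2 _ h3, fun j' hj' => ?_⟩
      obtain ⟨h1', h2', -⟩ := halt j'
      rw [hj'] at h2'
      refine isInterior_of_two_edges h1 h1' h3 h2' (fun hh => ?_)
      have := hinj hh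
      rw [← this] at hj'
      simp [Fin.ext_iff] at hj'
  exact (key _).1

variable [Fintype V]

theorem sum_mul_scaledLap (G : FinHypergraph V) (k : ℕ) (f g : V → ℝ) :
    ∑ v, g v * G.scaledLap k f v =
      ∑ e ∈ G.edges, (k * ∑ v ∈ e, g v * f v - (∑ v ∈ e, g v) * ∑ v ∈ e, f v) := by
  simp only [scaledLap, Finset.sum_filter, Finset.mul_sum G.edges]
  rw [Finset.sum_comm]
  refine Finset.sum_congr rfl fun e _ => ?_
  simp only [Finset.sum_ite_mem, mul_ite, mul_zero, Finset.univ_inter]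
  rw [Finset.mul_sum, Finset.sum_mul, ← Finset.sum_sub_distrib]
  exact Finset.sum_congr rfl fun v _ => by ring

theorem energy_eq_sum (G : FinHypergraph V) (k : ℕ) (f : V → ℝ) :
    G.energy k f = ∑ v, f v * G.scaledLap k f v := by
  rw [sum_mul_scaledLap, energy]
  exact Finset.sum_congr rfl fun e _ => by simp only [sq]

theorem energy_add (G : FinHypergraph V) (k : ℕ) (f g : V → ℝ) :
    G.energy k (f + g) = G.energy k f + 2 * ∑ v, g v * G.scaledLap k f v + G.energy k g := by
  rw [sum_mul_scaledLap, energy, energy, energy, Finset.mul_sum, ← Finset.sum_add_distrib,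
    ← Finset.sum_add_distrib]
  refine Finset.sum_congr rfl fun e _ => ?_
  have h1 : ∑ v ∈ e, (f + g) v ^ 2 =
      ∑ v ∈ e, f v ^ 2 + 2 * ∑ v ∈ e, g v * f v + ∑ v ∈ e, g v ^ 2 := by
    rw [Finset.mul_sum, ← Finset.sum_add_distrib, ← Finset.sum_add_distrib]
    exact Finset.sum_congr rfl fun v _ => by simp only [Pi.add_apply]; ring
  have h2 : ∑ v ∈ e, (f + g) v = ∑ v ∈ e, f v + ∑ v ∈ e, g v := by
    simp [Finset.sum_add_distrib]
  rw [h1, h2]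
  ring

/-- Uniformity makes each edge contribute the weight `1 / (k - 1)`, and the factor `k - 1` clears
it. -/
theorem scaledLap_eq {G : FinHypergraph V} {k : ℕ} (hk : 2 ≤ k) (hG : G.IsUniform k) (f : V → ℝ)
    (v : V) : G.scaledLap k f v = ((k : ℝ) - 1) * G.lapMatrix.mulVec f v := by
  have hk' : (k : ℝ) - 1 ≠ 0 := by
    have : (2 : ℝ) ≤ k := by exact_mod_cast hk
    linarith
  have hA : ((k : ℝ) - 1) * G.adjMatrix.mulVec f v =
      ∑ e ∈ G.edges with v ∈ e, (∑ w ∈ e, f w - f v) := by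
    have h1 : ∀ w, ((k : ℝ) - 1) * (G.adjMatrix v w * f w) =
        ∑ e ∈ G.edges with v ∈ e, if w ∈ e.erase v then f w else 0 := by
      intro w
      simp only [adjMatrix, Matrix.of_apply]
      by_cases hvw : v = w
      · subst hvw
        simp
      · rw [if_neg hvw]
        have h2 : ∑ e ∈ G.edges with v ∈ e ∧ w ∈ e, 1 / ((e.card : ℝ) - 1) =
            ∑ e ∈ G.edges with v ∈ e ∧ w ∈ e, 1 / ((k : ℝ) - 1) :=
          Finset.sum_congr rfl fun e he => by rw [hG e (Finset.mem_filter.1 he).1]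
        rw [h2, Finset.sum_const, ← Finset.sum_filter, Finset.sum_const, Finset.filter_filter]
        have h3 : (G.edges.filter fun e => v ∈ e ∧ w ∈ e.erase v) =
            G.edges.filter fun e => v ∈ e ∧ w ∈ e := by
          refine Finset.filter_congr fun e _ => ?_
          simp [Ne.symm hvw]
        rw [h3]
        simp only [nsmul_eq_mul]
        field_simp
    simp only [Matrix.mulVec, dotProduct]
    rw [Finset.mul_sum, Finset.sum_congr rfl fun w _ => h1 w, Finset.sum_comm]
    refine Finset.sum_congr rfl fun e he => ?_
    rw [Finset.sum_ite_mem, Finset.univ_inter, ← Finset.add_sum_erase e f (Finset.mem_filter.1 he).2]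
    ring
  rw [lapMatrix, Matrix.sub_mulVec, Pi.sub_apply, mul_sub, hA, Matrix.mulVec_diagonal, scaledLap,
    degree]
  simp only [Finset.sum_sub_distrib, Finset.sum_const, nsmul_eq_mul]
  ring

end Energy

/-! ### Variational characterization and positive ground state -/

section GroundState

variable {V : Type*} [Fintype V] [DecidableEq V]

/-- `f` is a positive first Dirichlet eigenfunction, and `c` is the first Dirichlet eigenvalue,
for the Laplacian multiplied by `k - 1`. -/
structure IsGroundState (G : FinHypergraph V) (k : ℕ) (c : ℝ) (f : V → ℝ) : Prop where
  pos : ∀ v, G.IsInterior v → 0 < f v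
  zero : ∀ v, G.IsBoundary v → f v = 0
  eigen : ∀ v, G.IsInterior v → G.scaledLap k f v = c * f v
  le_energy : ∀ g : V → ℝ, (∀ v, G.IsBoundary v → g v = 0) → c * ∑ v, g v ^ 2 ≤ G.energy k g

theorem energy_eq_of_eigen {G : FinHypergraph V} {k : ℕ} {c : ℝ} {f : V → ℝ}
    (hf : ∀ v, G.IsBoundary v → f v = 0)
    (h : ∀ v, G.IsInterior v → G.scaledLap k f v = c * f v) :
    G.energy k f = c * ∑ v, f v ^ 2 := by
  rw [energy_eq_sum, Finset.mul_sum]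
  refine Finset.sum_congr rfl fun v _ => ?_
  by_cases hv : G.IsBoundary v
  · simp [hf v hv]
  · rw [h v hv]; ring

/-- First variation: perturbing the minimizer `f` at the single interior vertex `v` gives a
quadratic `2 b t + D t ^ 2` that is non-negative for all `t`, so `b = 0`. -/
theorem eigen_of_energy_le {G : FinHypergraph V} {k : ℕ} {c : ℝ} {f : V → ℝ}
    (hc : ∀ g : V → ℝ, (∀ v, G.IsBoundary v → g v = 0) → c * ∑ v, g v ^ 2 ≤ G.energy k g)
    (hf : ∀ v, G.IsBoundary v → f v = 0) (hle : G.energy k f ≤ c * ∑ v, f v ^ 2) (v : V)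
    (hv : G.IsInterior v) : G.scaledLap k f v = c * f v := by
  set D := G.energy k (Pi.single v 1) - c with hD
  set b := G.scaledLap k f v - c * f v with hb
  have key : ∀ t : ℝ, 0 ≤ 2 * b * t + D * t ^ 2 := by
    intro t
    have h1 := hc (f + t • Pi.single v 1) (by
      intro w hw
      have : w ≠ v := by rintro rfl; exact hv hw
      simp [hf w hw, this])
    rw [energy_add, energy_smul] at h1
    have h2 : ∑ w, (t • (Pi.single v 1 : V → ℝ)) w * G.scaledLap k f w = t * G.scaledLap k f v := by
      rw [Finset.sum_eq_single v]
      · simp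
      · intro w _ hw; simp [hw]
      · simp
    have h3 : ∑ w, (f + t • (Pi.single v 1 : V → ℝ)) w ^ 2 =
        ∑ w, f w ^ 2 + (2 * t * f v + t ^ 2) := by
      have : ∀ w, (f + t • (Pi.single v 1 : V → ℝ)) w ^ 2 =
          f w ^ 2 + (if w = v then 2 * t * f v + t ^ 2 else 0) := by
        intro w
        by_cases hw : w = v
        · subst hw; simp; ring
        · simp [hw]
      rw [Finset.sum_congr rfl fun w _ => this w, Finset.sum_add_distrib]
      simp
    rw [h2, h3] at h1
    rw [hb, hD]
    nlinarith
  have hb0 : b = 0 := by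
    by_contra hne
    -- A step against the sign of `b`, short enough for the linear term to dominate; adding one
    -- avoids division by zero.
    have h1 := key (-b / (|D| + 1))
    have hpos : 0 < |D| + 1 := by positivity
    have h2 : 2 * b * (-b / (|D| + 1)) + D * (-b / (|D| + 1)) ^ 2 =
        b ^ 2 * (D - 2 * (|D| + 1)) / (|D| + 1) ^ 2 := by
      field_simp
      ring
    rw [h2] at h1
    have h3 : b ^ 2 * (D - 2 * (|D| + 1)) / (|D| + 1) ^ 2 < 0 := by
      apply div_neg_of_neg_of_pos _ (by positivity)
      apply mul_neg_of_pos_of_neg (by positivity)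
      have := le_abs_self D
      have := abs_nonneg D
      linarith
    linarith
  linarith

/-- The form attains its minimum on the compact unit sphere of the functions vanishing on the
boundary, and homogeneity extends the bound to all such functions. -/
theorem exists_energy_min {G : FinHypergraph V} (k : ℕ) (hint : ∃ v, G.IsInterior v) :
    ∃ (c : ℝ) (f : V → ℝ), ∑ v, f v ^ 2 = 1 ∧ (∀ v, G.IsBoundary v → f v = 0) ∧
      G.energy k f = c ∧
      ∀ g : V → ℝ, (∀ v, G.IsBoundary v → g v = 0) → c * ∑ v, g v ^ 2 ≤ G.energy k g := by
  obtain ⟨v₀, hv₀⟩ := hint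
  set K : Set (V → ℝ) := {g | ∑ v, g v ^ 2 = 1} ∩ {g | ∀ v, G.IsBoundary v → g v = 0} with hK
  have hclosed : IsClosed K := by
    refine IsClosed.inter (isClosed_eq (by fun_prop) continuous_const) ?_
    simp only [Set.ofPred_forall]
    exact isClosed_iInter fun v => isClosed_iInter fun _ =>
      isClosed_eq (continuous_apply v) continuous_const
  have hcompact : IsCompact K := by
    refine Metric.isCompact_of_isClosed_isBounded hclosed ?_
    refine (Metric.isBounded_closedBall (x := (0 : V → ℝ)) (r := 1)).subset ?_
    intro g hg
    rw [mem_closedBall_zero_iff, pi_norm_le_iff_of_nonneg zero_le_one]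
    intro v
    have h1 : g v ^ 2 ≤ ∑ w, g w ^ 2 :=
      Finset.single_le_sum (f := fun w => g w ^ 2) (fun w _ => sq_nonneg _) (Finset.mem_univ v)
    rw [hg.1] at h1
    rw [Real.norm_eq_abs]
    exact (sq_le_one_iff_abs_le_one _).1 h1
  have hne : K.Nonempty := by
    refine ⟨Pi.single v₀ 1, ?_, ?_⟩
    · simp only [Set.mem_ofPred_eq]
      rw [Finset.sum_eq_single v₀]
      · simp
      · intro w _ hw; simp [hw]
      · simp
    · intro v hv
      have : v ≠ v₀ := by rintro rfl; exact hv₀ hv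
      simp [this]
  obtain ⟨f, hf, hmin⟩ := hcompact.exists_isMinOn hne (energy_continuous G k).continuousOn
  refine ⟨G.energy k f, f, hf.1, hf.2, rfl, fun g hg => ?_⟩
  rcases eq_or_ne (∑ v, g v ^ 2) 0 with h0 | h0
  · have hz : g = 0 := by
      funext v
      have := (Finset.sum_eq_zero_iff_of_nonneg fun w _ => sq_nonneg (g w)).1 h0 v
        (Finset.mem_univ v)
      simpa using this
    rw [h0, hz]
    simp [energy]
  · have hs : 0 < ∑ v, g v ^ 2 :=
      lt_of_le_of_ne (Finset.sum_nonneg fun w _ => sq_nonneg _) (Ne.symm h0)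
    set s := Real.sqrt (∑ v, g v ^ 2) with hsdef
    have hs2 : s ^ 2 = ∑ v, g v ^ 2 := Real.sq_sqrt hs.le
    have hspos : 0 < s := Real.sqrt_pos.2 hs
    have hmem : s⁻¹ • g ∈ K := by
      refine ⟨?_, fun v hv => by simp [hg v hv]⟩
      simp only [Set.mem_ofPred_eq, Pi.smul_apply, smul_eq_mul, mul_pow, ← Finset.mul_sum]
      rw [← hs2]
      field_simp
    have h1 : G.energy k f ≤ G.energy k (s⁻¹ • g) := hmin hmem
    rw [energy_smul] at h1
    rw [← hs2]
    have h2 := mul_le_mul_of_nonneg_right h1 (sq_nonneg s)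
    have h3 : s⁻¹ ^ 2 * G.energy k g * s ^ 2 = G.energy k g := by field_simp
    linarith

/-- Taking absolute values does not raise the form, so `|g|` is a minimizer and hence an
eigenfunction. It is positive at interior vertices by `eq_zero_of_eigen`. -/
theorem exists_isGroundState {G : FinHypergraph V} {k : ℕ} (hk : 2 ≤ k) (hG : G.IsUniform k)
    (hcon : G.IsConnected) (hint : ∃ v, G.IsInterior v) :
    ∃ f, G.IsGroundState k (((k : ℝ) - 1) * G.firstDirichletEigenvalue) f := by
  have hk' : (0 : ℝ) < (k : ℝ) - 1 := by
    have : (2 : ℝ) ≤ k := by exact_mod_cast hk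
    linarith
  obtain ⟨c, g, hg1, hg0, hgc, hc⟩ := exists_energy_min k hint
  have hle : G.energy k (fun v => |g v|) ≤ c * ∑ v, |g v| ^ 2 := by
    simp only [sq_abs]
    rw [hg1, mul_one, ← hgc]
    exact energy_abs_le G k g
  have hb : ∀ v, G.IsBoundary v → |g v| = 0 := fun v hv => by rw [hg0 v hv, abs_zero]
  have heig := eigen_of_energy_le hc hb hle
  have hne : (fun v => |g v|) ≠ 0 := by
    intro h0
    have : ∑ v, g v ^ 2 = 0 := Finset.sum_eq_zero fun v _ => by
      rw [← sq_abs, show |g v| = 0 from congrFun h0 v]; ring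
    linarith
  have hfirst : ((k : ℝ) - 1) * G.firstDirichletEigenvalue = c := by
    have hleast : IsLeast {c : ℝ | G.IsDirichletEigenvalue c} (c / ((k : ℝ) - 1)) := by
      constructor
      · refine ⟨fun v => |g v|, hne, fun v hv => ?_, hb⟩
        have := heig v hv
        rw [scaledLap_eq hk hG] at this
        field_simp
        linarith
      · rintro c' ⟨f, hf0, hf1, hf2⟩
        rw [div_le_iff₀ hk']
        have h1 : ∀ v, G.IsInterior v → G.scaledLap k f v = (((k : ℝ) - 1) * c') * f v := by
          intro v hv
          rw [scaledLap_eq hk hG, hf1 v hv]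
          ring
        have h2 := energy_eq_of_eigen hf2 h1
        have h3 := hc f hf2
        rw [h2] at h3
        have h4 : 0 < ∑ v, f v ^ 2 := by
          refine lt_of_le_of_ne (Finset.sum_nonneg fun w _ => sq_nonneg _) (fun h0 => hf0 ?_)
          funext v
          simpa using (Finset.sum_eq_zero_iff_of_nonneg fun w _ => sq_nonneg (f w)).1 h0.symm v
            (Finset.mem_univ v)
        have := le_of_mul_le_mul_right h3 h4
        linarith
    rw [firstDirichletEigenvalue, hleast.csInf_eq]
    field_simp
  rw [hfirst]
  refine ⟨fun v => |g v|, fun v hv => ?_, hb, heig, hc⟩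
  refine lt_of_le_of_ne (abs_nonneg _) fun h0 => hne ?_
  exact eq_zero_of_eigen hcon (fun v => abs_nonneg _) hb heig hv h0.symm

end GroundState

/-! ### Isomorphism invariance of the first eigenvalue -/

section Isomorphism

theorem Isomorphic.symm {V W : Type*} {G : FinHypergraph V} {H : FinHypergraph W}
    (h : G.Isomorphic H) : H.Isomorphic G := by
  obtain ⟨σ, hσ⟩ := h
  refine ⟨σ.symm, fun e => ?_⟩
  rw [← hσ, Finset.map_map]
  simp

theorem edges_eq_map {V W : Type*} {G : FinHypergraph V} {H : FinHypergraph W} {σ : V ≃ W}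
    (hσ : ∀ e : Finset V, e.map σ.toEmbedding ∈ H.edges ↔ e ∈ G.edges) :
    H.edges = G.edges.map (Finset.mapEmbedding σ.toEmbedding).toEmbedding := by
  ext e
  simp only [Finset.mem_map, RelEmbedding.coe_toEmbedding, Finset.mapEmbedding_apply]
  constructor
  · intro he
    refine ⟨e.map σ.symm.toEmbedding, ?_, ?_⟩
    · rw [← hσ, Finset.map_map]; simpa using he
    · rw [Finset.map_map]; simp
  · rintro ⟨e', he', rfl⟩
    exact (hσ e').2 he'

variable {V W : Type*} [Fintype V] [DecidableEq V] [Fintype W] [DecidableEq W]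

theorem IsDirichletEigenvalue.of_isomorphic {G : FinHypergraph V} {H : FinHypergraph W}
    (h : G.Isomorphic H) {c : ℝ} (hc : H.IsDirichletEigenvalue c) :
    G.IsDirichletEigenvalue c := by
  obtain ⟨σ, hσ⟩ := h
  obtain ⟨f, hf0, hf1, hf2⟩ := hc
  have hE := edges_eq_map hσ
  have hdeg : ∀ v, H.degree (σ v) = G.degree v := by
    intro v
    rw [degree, degree, hE, Finset.filter_map, Finset.card_map]
    congr 1
    refine Finset.filter_congr fun e _ => ?_
    simp
  have hA : ∀ v w, H.adjMatrix (σ v) (σ w) = G.adjMatrix v w := by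
    intro v w
    simp only [adjMatrix, Matrix.of_apply, σ.injective.eq_iff]
    rw [hE, Finset.filter_map, Finset.sum_map]
    congr 1
    refine Finset.sum_congr ?_ fun e _ => by simp
    refine Finset.filter_congr fun e _ => ?_
    simp
  have hint : ∀ v, H.IsBoundary (σ v) ↔ G.IsBoundary v := fun v => by
    rw [IsBoundary, IsBoundary, hdeg]
  refine ⟨f ∘ σ, fun h0 => hf0 ?_, fun v hv => ?_, fun v hv => hf2 _ ((hint v).2 hv)⟩
  · funext w
    simpa using congrFun h0 (σ.symm w)
  · have h1 := hf1 (σ v) (fun hb => hv ((hint v).1 hb))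
    rw [Function.comp_apply, ← h1]
    rw [lapMatrix, lapMatrix, Matrix.sub_mulVec, Matrix.sub_mulVec, Pi.sub_apply, Pi.sub_apply,
      Matrix.mulVec_diagonal, Matrix.mulVec_diagonal, hdeg]
    congr 1
    simp only [Matrix.mulVec, dotProduct, Function.comp_apply]
    rw [← Equiv.sum_comp σ]
    exact Finset.sum_congr rfl fun w _ => by rw [hA]

theorem Isomorphic.firstDirichletEigenvalue_eq {G : FinHypergraph V} {H : FinHypergraph W}
    (h : G.Isomorphic H) : G.firstDirichletEigenvalue = H.firstDirichletEigenvalue := by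
  unfold firstDirichletEigenvalue
  congr 1
  ext c
  exact ⟨fun hc => hc.of_isomorphic h.symm, fun hc => hc.of_isomorphic h⟩

end Isomorphism

/-! ### Exchanging members of two edges in a minimizer -/

section Extremal

variable {V : Type*} [DecidableEq V]

theorem scaledLap_eq_sum {G : FinHypergraph V} {k : ℕ} (hG : G.IsUniform k) (f : V → ℝ) (v : V) :
    G.scaledLap k f v = ∑ e ∈ G.edges with v ∈ e, ∑ w ∈ e, (f v - f w) := by
  refine Finset.sum_congr rfl fun e he => ?_
  rw [Finset.sum_sub_distrib, Finset.sum_const, hG e (Finset.mem_filter.1 he).1, nsmul_eq_mul]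

theorem degree_eq_sum (G : FinHypergraph V) (v : V) :
    G.degree v = ∑ e ∈ G.edges, if v ∈ e then 1 else 0 := by
  rw [degree, Finset.card_filter]

theorem exists_edge_ne {G : FinHypergraph V} {v : V} (hv : 2 ≤ G.degree v) (e : Finset V) :
    ∃ e' ∈ G.edges, v ∈ e' ∧ e' ≠ e := by
  obtain ⟨e', he', hne⟩ := Finset.exists_mem_ne (s := G.edges.filter fun e => v ∈ e) hv e
  rw [Finset.mem_filter] at he'
  exact ⟨e', he'.1, he'.2, hne⟩

/-- The edges `e₁` and `e₂` are joined by a path that leaves them at `x₁` and `x₂`. -/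
structure Gate (G : FinHypergraph V) (e₁ : Finset V) (x₁ : V) (e₂ : Finset V)
    (x₂ : V) : Prop where
  mem₁ : e₁ ∈ G.edges
  mem₂ : e₂ ∈ G.edges
  ne : e₁ ≠ e₂
  x_mem₁ : x₁ ∈ e₁
  x_mem₂ : x₂ ∈ e₂
  reachable : (link ((G.edges.erase e₁).erase e₂)).Reachable x₁ x₂

theorem Gate.symm {G : FinHypergraph V} {e₁ e₂ : Finset V} {x₁ x₂ : V} (g : G.Gate e₁ x₁ e₂ x₂) :
    G.Gate e₂ x₂ e₁ x₁ :=
  ⟨g.mem₂, g.mem₁, g.ne.symm, g.x_mem₂, g.x_mem₁, by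
    rw [Finset.erase_right_comm]; exact g.reachable.symm⟩

variable [Fintype V]

/-- `f` is the ground state of the supertree `G`, with eigenvalue `c`, and `c` is a lower bound
for the Dirichlet forms of all supertrees with the same boundary whose interior degrees are at
least `d`. -/
structure IsExtremal (G : FinHypergraph V) (k d : ℕ) (c : ℝ) (f : V → ℝ) : Prop where
  two_le : 2 ≤ k
  two_le_degree : 2 ≤ d
  uniform : G.IsUniform k
  supertree : G.IsSupertree
  ground : G.IsGroundState k c f
  le_degree : ∀ v, G.IsInterior v → d ≤ G.degree v
  exists_interior : ∃ v, G.IsInterior v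
  le_energy : ∀ H : FinHypergraph V, H.IsUniform k → H.IsSupertree →
    (∀ v, H.IsBoundary v ↔ G.IsBoundary v) → (∀ v, G.IsInterior v → d ≤ H.degree v) →
    ∀ g : V → ℝ, (∀ v, G.IsBoundary v → g v = 0) → c * ∑ v, g v ^ 2 ≤ H.energy k g

/-- A vertex of greatest height has no edge below it, so it lies only in its parent edge. -/
theorem exists_boundary {G : FinHypergraph V} {k : ℕ} (hk : 2 ≤ k) (hu : G.IsUniform k)
    (hG : G.IsSupertree) {r : V} (hr : 2 ≤ G.degree r) : ∃ v, G.IsBoundary v := by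
  obtain ⟨h, top, pe, R⟩ := hG.exists_rooted r
  have : Nonempty V := ⟨r⟩
  obtain ⟨v, hv⟩ := Finite.exists_max h
  obtain ⟨e, he, hre, -⟩ := exists_edge_ne hr ∅
  obtain ⟨w, hw, hwr⟩ := Finset.exists_mem_ne (s := e) (by rw [hu e he]; omega) r
  have hvr : v ≠ r := by
    rintro rfl
    have h1 := hv w
    rw [(R.h_eq_zero v).2 rfl] at h1
    exact hwr ((R.h_eq_zero w).1 (by omega))
  refine ⟨v, Finset.card_eq_one.2 ⟨pe v, ?_⟩⟩
  ext e'
  rw [Finset.mem_filter, Finset.mem_singleton]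
  constructor
  · rintro ⟨he', hve'⟩
    by_contra hne
    have ht := R.eq_top_of_ne he' hve' hne
    obtain ⟨y, hy, hyv⟩ := Finset.exists_mem_ne (s := e') (by rw [hu e' he']; omega) v
    have h2 := R.h_of_mem e' he' y hy (by rwa [← ht])
    have h3 := hv y
    rw [← ht] at h2
    omega
  · rintro rfl
    exact ⟨R.pe_mem v hvr, R.mem_pe v hvr⟩

namespace IsExtremal

variable {G : FinHypergraph V} {k d : ℕ} {c : ℝ} {f : V → ℝ}

theorem nonneg (X : G.IsExtremal k d c f) (v : V) : 0 ≤ f v := by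
  by_cases hv : G.IsBoundary v
  · exact (X.ground.zero v hv).ge
  · exact (X.ground.pos v hv).le

theorem interior_iff (X : G.IsExtremal k d c f) {v : V} : G.IsInterior v ↔ 0 < f v := by
  refine ⟨X.ground.pos v, fun h hb => ?_⟩
  rw [X.ground.zero v hb] at h
  exact lt_irrefl _ h

theorem two_le_degree_of_pos (X : G.IsExtremal k d c f) {v : V} (hv : 0 < f v) :
    2 ≤ G.degree v :=
  X.two_le_degree.trans (X.le_degree v (X.interior_iff.2 hv))

/-- Maximum principle: if `c ≤ 0`, all neighbours of a maximum are maxima, and by connectivity so is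
a boundary vertex, where `f` vanishes. -/
theorem eigenvalue_pos (X : G.IsExtremal k d c f) : 0 < c := by
  obtain ⟨v₀, hv₀⟩ := X.exists_interior
  have : Nonempty V := ⟨v₀⟩
  obtain ⟨r, hr⟩ := Finite.exists_max f
  have hrpos : 0 < f r := (X.ground.pos v₀ hv₀).trans_le (hr v₀)
  by_contra hc
  rw [not_lt] at hc
  have step : ∀ v, f v = f r → ∀ e ∈ G.edges, v ∈ e → ∀ w ∈ e, f w = f r := by
    intro v hv e he hve w hw
    have h1 := X.ground.eigen v (X.interior_iff.2 (hv ▸ hrpos))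
    rw [scaledLap_eq_sum X.uniform] at h1
    have h2 : ∀ e ∈ G.edges.filter (fun e => v ∈ e), 0 ≤ ∑ w ∈ e, (f v - f w) :=
      fun e _ => Finset.sum_nonneg fun w _ => by rw [hv]; exact sub_nonneg.2 (hr w)
    have h3 : ∑ e ∈ G.edges with v ∈ e, ∑ w ∈ e, (f v - f w) = 0 := by
      refine le_antisymm ?_ (Finset.sum_nonneg h2)
      rw [h1, hv]
      exact mul_nonpos_of_nonpos_of_nonneg hc hrpos.le
    have h4 := (Finset.sum_eq_zero_iff_of_nonneg h2).1 h3 e (Finset.mem_filter.2 ⟨he, hve⟩)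
    have h5 := (Finset.sum_eq_zero_iff_of_nonneg
      (fun w _ => by rw [hv]; exact sub_nonneg.2 (hr w))).1 h4 w hw
    linarith
  obtain ⟨b, hb⟩ := exists_boundary X.two_le X.uniform X.supertree (X.two_le_degree_of_pos hrpos)
  have hall : ∀ v, (link G.edges).Reachable r v → f v = f r := by
    rintro v hv
    obtain ⟨w⟩ := hv.symm
    induction w with
    | nil => rfl
    | cons hadj _ ih =>
      obtain ⟨-, e, he, hx, hy⟩ := hadj
      exact step _ (ih hr hrpos step (X.supertree.1.reachable _ _)) e he hy _ hx
  have := hall b (X.supertree.1.reachable r b)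
  rw [X.ground.zero b hb] at this
  linarith

/-- If another supertree of the class has no larger energy, then `f` is its eigenfunction, too. -/
theorem scaledLap_eq (X : G.IsExtremal k d c f) {H : FinHypergraph V} (hu : H.IsUniform k)
    (hs : H.IsSupertree) (hb : ∀ v, H.IsBoundary v ↔ G.IsBoundary v)
    (hd : ∀ v, G.IsInterior v → d ≤ H.degree v) (hle : H.energy k f ≤ G.energy k f) :
    (∀ v, 0 < f v → H.scaledLap k f v = G.scaledLap k f v) ∧ H.energy k f = G.energy k f := by
  have h1 := X.le_energy H hu hs hb hd
  have h2 := energy_eq_of_eigen X.ground.zero X.ground.eigen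
  have h3 : ∀ v, 0 < f v → H.scaledLap k f v = G.scaledLap k f v := by
    intro v hv
    have hv' := X.interior_iff.2 hv
    rw [X.ground.eigen v hv']
    refine eigen_of_energy_le (fun g hg => h1 g fun w hw => hg w ((hb w).2 hw))
      (fun w hw => X.ground.zero w ((hb w).1 hw)) (by rw [← h2]; exact hle) v
      (fun hh => hv' ((hb v).1 hh))
  exact ⟨h3, le_antisymm hle (by rw [h2]; exact h1 f X.ground.zero)⟩

/-- Exchanging `z₁` and `z₂` keeps all degrees and changes the form by twice the displayed product,
which extremality makes non-negative. If it is zero, comparing the Laplacians at `z₁` and at `w`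
gives the two equalities. The vertices `p₁` and `p₂` witness that the new edges are still connected
through the old ones. -/
theorem swap (X : G.IsExtremal k d c f) {e₁ e₂ : Finset V} (h₁ : e₁ ∈ G.edges)
    (h₂ : e₂ ∈ G.edges) (hne : e₁ ≠ e₂) {z₁ z₂ : V} (hz₁ : z₁ ∈ e₁) (hz₂ : z₂ ∈ e₂)
    (hz₁' : z₁ ∉ e₂) (hz₂' : z₂ ∉ e₁) {p₁ p₂ : V} (hp₁ : p₁ ∈ insert z₂ (e₁.erase z₁))
    (hp₂ : p₂ ∈ insert z₁ (e₂.erase z₂))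
    (hr : (link ((G.edges.erase e₁).erase e₂)).Reachable p₁ p₂) {b₁ b₂ : ℝ}
    (hb₁ : ∑ v ∈ e₁, f v = f z₁ + b₁) (hb₂ : ∑ v ∈ e₂, f v = f z₂ + b₂) :
    0 ≤ (f z₁ - f z₂) * (b₁ - b₂) ∧ ((f z₁ - f z₂) * (b₁ - b₂) = 0 →
      (0 < f z₁ → b₁ = b₂) ∧
      ∀ w ∈ e₁, w ≠ z₁ → w ∉ e₂ → 0 < f w → f z₁ = f z₂) := by
  have hzz : z₁ ≠ z₂ := by rintro rfl; exact hz₁' hz₂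
  set rest := (G.edges.erase e₁).erase e₂ with hrest
  have m₂ : e₂ ∈ G.edges.erase e₁ := Finset.mem_erase.2 ⟨hne.symm, h₂⟩
  set e₁' := insert z₂ (e₁.erase z₁) with he₁'
  set e₂' := insert z₁ (e₂.erase z₂) with he₂'
  have n₁ : z₂ ∉ e₁.erase z₁ := fun hh => hz₂' (Finset.mem_of_mem_erase hh)
  have n₂ : z₁ ∉ e₂.erase z₂ := fun hh => hz₁' (Finset.mem_of_mem_erase hh)
  have hcard₁ : e₁'.card = k := by
    rw [he₁', Finset.card_insert_of_notMem n₁, Finset.card_erase_add_one hz₁, X.uniform e₁ h₁]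
  have hcard₂ : e₂'.card = k := by
    rw [he₂', Finset.card_insert_of_notMem n₂, Finset.card_erase_add_one hz₂, X.uniform e₂ h₂]
  have hrest_sub : ∀ e ∈ rest, e ∈ G.edges := fun e he =>
    Finset.mem_of_mem_erase (Finset.mem_of_mem_erase he)
  let H : FinHypergraph V := ⟨insert e₁' (insert e₂' rest), by
    intro e he
    rw [Finset.mem_insert, Finset.mem_insert] at he
    rcases he with rfl | rfl | he
    · exact ⟨z₂, Finset.mem_insert_self _ _⟩
    · exact ⟨z₁, Finset.mem_insert_self _ _⟩
    · exact G.nonempty_of_mem e (hrest_sub e he)⟩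
  have hHE : H.edges = insert e₁' (insert e₂' rest) := rfl
  have hHu : H.IsUniform k := by
    intro e he
    rw [hHE, Finset.mem_insert, Finset.mem_insert] at he
    rcases he with rfl | rfl | he
    · exact hcard₁
    · exact hcard₂
    · exact X.uniform e (hrest_sub e he)
  have hcr : rest.card + 2 = G.edges.card := by
    have a1 : rest.card + 1 = _ := Finset.card_erase_add_one m₂
    have a2 := Finset.card_erase_add_one h₁
    omega
  have hle : H.edges.card ≤ G.edges.card := by
    have a1 := Finset.card_insert_le e₁' (insert e₂' rest)
    have a2 := Finset.card_insert_le e₂' rest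
    rw [hHE]; omega
  have hm₁ : e₁' ∈ H.edges := Finset.mem_insert_self _ _
  have hm₂ : e₂' ∈ H.edges := Finset.mem_insert_of_mem (Finset.mem_insert_self _ _)
  have hrsub : rest ⊆ H.edges := fun e he =>
    Finset.mem_insert_of_mem (Finset.mem_insert_of_mem he)
  have hp : (link H.edges).Reachable p₂ p₁ := (reachable_mono hrsub hr).symm
  have q₁ : ∀ w ∈ e₁', (link H.edges).Reachable w p₁ := fun w hw => reachable_of_mem hm₁ hw hp₁
  have q₂ : ∀ w ∈ e₂', (link H.edges).Reachable w p₁ := fun w hw =>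
    (reachable_of_mem hm₂ hw hp₂).trans hp
  have r₁ : ∀ w ∈ e₁, (link H.edges).Reachable w p₁ := by
    intro w hw
    by_cases hwz : w = z₁
    · exact q₂ w (hwz ▸ Finset.mem_insert_self _ _)
    · exact q₁ w (Finset.mem_insert_of_mem (Finset.mem_erase.2 ⟨hwz, hw⟩))
  have r₂ : ∀ w ∈ e₂, (link H.edges).Reachable w p₁ := by
    intro w hw
    by_cases hwz : w = z₂
    · exact q₁ w (hwz ▸ Finset.mem_insert_self _ _)
    · exact q₂ w (Finset.mem_insert_of_mem (Finset.mem_erase.2 ⟨hwz, hw⟩))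
  obtain ⟨hHs, hHc⟩ := X.supertree.of_reachable X.two_le X.uniform hHu hle (by
    intro e he x hx y hy
    by_cases hee₁ : e = e₁
    · subst hee₁; exact (r₁ x hx).trans (r₁ y hy).symm
    by_cases hee₂ : e = e₂
    · subst hee₂; exact (r₂ x hx).trans (r₂ y hy).symm
    exact reachable_of_mem (hrsub (Finset.mem_erase.2 ⟨hee₂, Finset.mem_erase.2 ⟨hee₁, he⟩⟩)) hx hy)
  -- The number of edges is unchanged, so the new edges coincide neither with each other nor with
  -- old ones.
  have u₂ : e₂' ∉ rest := by
    intro hh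
    have a1 := Finset.card_insert_le e₁' (insert e₂' rest)
    rw [Finset.insert_eq_of_mem hh] at a1
    rw [hHE, Finset.insert_eq_of_mem hh] at hHc
    omega
  have u₁ : e₁' ∉ insert e₂' rest := by
    intro hh
    have a1 := Finset.card_insert_le e₂' rest
    rw [hHE, Finset.insert_eq_of_mem hh] at hHc
    omega
  have sumG : ∀ {M : Type} [AddCommMonoid M] (φ : Finset V → M),
      ∑ e ∈ G.edges, φ e = φ e₁ + (φ e₂ + ∑ e ∈ rest, φ e) := by
    intro M _ φ
    rw [← Finset.add_sum_erase _ _ h₁, ← Finset.add_sum_erase _ _ m₂]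
  have sumH : ∀ {M : Type} [AddCommMonoid M] (φ : Finset V → M),
      ∑ e ∈ H.edges, φ e = φ e₁' + (φ e₂' + ∑ e ∈ rest, φ e) := by
    intro M _ φ
    rw [hHE, Finset.sum_insert u₁, Finset.sum_insert u₂]
  have s₁ : ∀ g : V → ℝ, ∑ v ∈ e₁', g v = ∑ v ∈ e₁, g v - g z₁ + g z₂ := by
    intro g
    rw [he₁', Finset.sum_insert n₁, ← Finset.add_sum_erase e₁ g hz₁]; ring
  have s₂ : ∀ g : V → ℝ, ∑ v ∈ e₂', g v = ∑ v ∈ e₂, g v - g z₂ + g z₁ := by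
    intro g
    rw [he₂', Finset.sum_insert n₂, ← Finset.add_sum_erase e₂ g hz₂]; ring
  have i₁ : ∀ w, w ∈ e₁' ↔ w = z₂ ∨ (w ≠ z₁ ∧ w ∈ e₁) := fun w => by
    rw [he₁', Finset.mem_insert, Finset.mem_erase]
  have i₂ : ∀ w, w ∈ e₂' ↔ w = z₁ ∨ (w ≠ z₂ ∧ w ∈ e₂) := fun w => by
    rw [he₂', Finset.mem_insert, Finset.mem_erase]
  have hdeg : ∀ v, H.degree v = G.degree v := by
    intro v
    rw [degree_eq_sum, degree_eq_sum, sumH, sumG, ← add_assoc, ← add_assoc]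
    congr 1
    simp only [i₁, i₂]
    by_cases v1 : v = z₁
    · subst v1; simp [hzz, hz₁, hz₁']
    · by_cases v2 : v = z₂
      · subst v2; simp [Ne.symm hzz, hz₂, hz₂']
      · simp [v1, v2]
  have hbd : ∀ v, H.IsBoundary v ↔ G.IsBoundary v := fun v => by
    rw [IsBoundary, IsBoundary, hdeg]
  have hen : H.energy k f - G.energy k f = 2 * ((f z₁ - f z₂) * (b₁ - b₂)) := by
    rw [energy, energy, sumH, sumG]
    have a1 := s₁ (fun v => f v ^ 2)
    have a2 := s₂ (fun v => f v ^ 2)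
    rw [s₁ f, s₂ f, a1, a2, hb₁, hb₂]
    ring
  have main : (f z₁ - f z₂) * (b₁ - b₂) ≤ 0 → (f z₁ - f z₂) * (b₁ - b₂) = 0 ∧
      ∀ v, 0 < f v → H.scaledLap k f v = G.scaledLap k f v := by
    intro hle
    obtain ⟨a1, a2⟩ := X.scaledLap_eq hHu hHs hbd (fun v hv => hdeg v ▸ X.le_degree v hv)
      (by linarith)
    exact ⟨by linarith, a1⟩
  refine ⟨?_, fun h0 => ?_⟩
  · by_contra hneg
    have := (main (not_le.1 hneg).le).1
    linarith
  · have hlap := (main h0.le).2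
    have expand : ∀ v, 0 < f v →
        (if v ∈ e₁' then k * f v - ∑ w ∈ e₁', f w else 0) +
          (if v ∈ e₂' then k * f v - ∑ w ∈ e₂', f w else 0) =
        (if v ∈ e₁ then k * f v - ∑ w ∈ e₁, f w else 0) +
          (if v ∈ e₂ then k * f v - ∑ w ∈ e₂, f w else 0) := by
      intro v hv
      have := hlap v hv
      rw [scaledLap, scaledLap, Finset.sum_filter, Finset.sum_filter, sumH, sumG] at this
      linarith
    refine ⟨fun hpos => ?_, fun w hw hwz hw2 hpos => ?_⟩
    · have := expand z₁ hpos
      rw [if_neg (fun hh => by simpa [hzz] using (i₁ z₁).1 hh), if_pos ((i₂ z₁).2 (Or.inl rfl)),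
        if_pos hz₁, if_neg hz₁', s₂, hb₁, hb₂] at this
      linarith
    · have := expand w hpos
      rw [if_pos ((i₁ w).2 (Or.inr ⟨hwz, hw⟩)), if_neg (fun hh => by
        rcases (i₂ w).1 hh with a | a
        · exact hwz a
        · exact hw2 a.2), if_pos hw, if_neg hw2, s₁, hb₁] at this
      linarith

variable {e₁ e₂ : Finset V} {x₁ x₂ : V}

theorem notMem_of_ne (X : G.IsExtremal k d c f) (g : G.Gate e₁ x₁ e₂ x₂) {y : V} (hy : y ∈ e₁)
    (hne : y ≠ x₁) : y ∉ e₂ := fun hh =>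
  hne (X.supertree.2.inter_subset g.mem₁ g.mem₂ g.ne g.x_mem₁ g.x_mem₂ g.reachable hy hh).1

theorem gate_notMem (X : G.IsExtremal k d c f) (g : G.Gate e₁ x₁ e₂ x₂) (hne : x₁ ≠ x₂) :
    x₁ ∉ e₂ := fun hh =>
  hne (X.supertree.2.inter_subset g.mem₁ g.mem₂ g.ne g.x_mem₁ g.x_mem₂ g.reachable g.x_mem₁ hh).2

/-- Exchanging the gates amounts to exchanging all other members, with their branches, between the
two ends of the path. -/
theorem swap_gates (X : G.IsExtremal k d c f) (g : G.Gate e₁ x₁ e₂ x₂) (hne : x₁ ≠ x₂) {T₁ T₂ : ℝ}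
    (hT₁ : ∑ v ∈ e₁, f v = f x₁ + T₁) (hT₂ : ∑ v ∈ e₂, f v = f x₂ + T₂) :
    0 ≤ (f x₁ - f x₂) * (T₁ - T₂) ∧ ((f x₁ - f x₂) * (T₁ - T₂) = 0 →
      (0 < f x₁ → T₁ = T₂) ∧ ∀ w ∈ e₁, w ≠ x₁ → 0 < f w → f x₁ = f x₂) := by
  obtain ⟨h1, h2⟩ := X.swap g.mem₁ g.mem₂ g.ne g.x_mem₁ g.x_mem₂ (X.gate_notMem g hne)
    (X.gate_notMem g.symm hne.symm) (Finset.mem_insert_self _ _) (Finset.mem_insert_self _ _)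
    g.reachable.symm hT₁ hT₂
  exact ⟨h1, fun h0 => ⟨(h2 h0).1, fun w hw hwx hpos =>
    (h2 h0).2 w hw hwx (X.notMem_of_ne g hw hwx) hpos⟩⟩

/-- The gates stay in place and keep the new edges connected; only the branches at `y₁` and `y₂`
trade places. -/
theorem swap_members (X : G.IsExtremal k d c f) (g : G.Gate e₁ x₁ e₂ x₂) {y₁ y₂ : V}
    (hy₁ : y₁ ∈ e₁) (hy₁' : y₁ ≠ x₁) (hy₂ : y₂ ∈ e₂) (hy₂' : y₂ ≠ x₂) {b₁ b₂ : ℝ}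
    (hb₁ : ∑ v ∈ e₁, f v = f y₁ + b₁) (hb₂ : ∑ v ∈ e₂, f v = f y₂ + b₂) :
    0 ≤ (f y₁ - f y₂) * (b₁ - b₂) ∧ ((f y₁ - f y₂) * (b₁ - b₂) = 0 → (0 < f y₁ → b₁ = b₂)) := by
  obtain ⟨h1, h2⟩ := X.swap g.mem₁ g.mem₂ g.ne hy₁ hy₂ (X.notMem_of_ne g hy₁ hy₁')
    (X.notMem_of_ne g.symm hy₂ hy₂')
    (Finset.mem_insert_of_mem (Finset.mem_erase.2 ⟨hy₁'.symm, g.x_mem₁⟩))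
    (Finset.mem_insert_of_mem (Finset.mem_erase.2 ⟨hy₂'.symm, g.x_mem₂⟩)) g.reachable hb₁ hb₂
  exact ⟨h1, fun h0 => (h2 h0).1⟩

/-- The members of an edge whose gate has the larger value have larger values. -/
theorem lt_of_gate_lt (X : G.IsExtremal k d c f) (g : G.Gate e₁ x₁ e₂ x₂) (hlt : f x₁ < f x₂)
    {y₁ y₂ : V} (hy₁ : y₁ ∈ e₁) (hy₁' : y₁ ≠ x₁) (hy₂ : y₂ ∈ e₂) (hy₂' : y₂ ≠ x₂)
    (hpos : 0 < f y₁) : f y₁ < f y₂ := by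
  by_contra hle
  rw [not_lt] at hle
  have hne : x₁ ≠ x₂ := by rintro rfl; exact lt_irrefl _ hlt
  obtain ⟨T₁, hT₁⟩ : ∃ T, ∑ v ∈ e₁, f v = f x₁ + T := ⟨∑ v ∈ e₁, f v - f x₁, by ring⟩
  obtain ⟨T₂, hT₂⟩ : ∃ T, ∑ v ∈ e₂, f v = f x₂ + T := ⟨∑ v ∈ e₂, f v - f x₂, by ring⟩
  obtain ⟨a1, a2⟩ := X.swap_gates g hne hT₁ hT₂
  -- Swapping the gates gives `T₁ ≤ T₂`, and equality would force equal gate values. Hence the sum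
  -- over `e₁` is strictly smaller, and swapping `y₁` with `y₂` contradicts `f y₂ ≤ f y₁`.
  have hT : T₁ < T₂ := by
    rcases lt_trichotomy T₁ T₂ with h | h | h
    · exact h
    · have := (a2 (by rw [h]; ring)).2 y₁ hy₁ hy₁' hpos
      linarith
    · nlinarith
  obtain ⟨c1, c2⟩ := X.swap_members g hy₁ hy₁' hy₂ hy₂' (b₁ := ∑ v ∈ e₁, f v - f y₁)
    (b₂ := ∑ v ∈ e₂, f v - f y₂) (by ring) (by ring)
  have hb : ∑ v ∈ e₁, f v - f y₁ < ∑ v ∈ e₂, f v - f y₂ := by linarith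
  have heq : (f y₁ - f y₂) * (∑ v ∈ e₁, f v - f y₁ - (∑ v ∈ e₂, f v - f y₂)) = 0 :=
    le_antisymm (mul_nonpos_of_nonneg_of_nonpos (by linarith) (by linarith)) c1
  exact absurd (c2 heq hpos) hb.ne

theorem le_of_gate_lt (X : G.IsExtremal k d c f) (g : G.Gate e₁ x₁ e₂ x₂) (hlt : f x₁ < f x₂)
    {y₁ y₂ : V} (hy₁ : y₁ ∈ e₁) (hy₁' : y₁ ≠ x₁) (hy₂ : y₂ ∈ e₂) (hy₂' : y₂ ≠ x₂) :
    f y₁ ≤ f y₂ := by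
  rcases (X.nonneg y₁).lt_or_eq with h | h
  · exact (X.lt_of_gate_lt g hlt hy₁ hy₁' hy₂ hy₂' h).le
  · rw [← h]; exact X.nonneg y₂

/-- Edges whose distinct gates have the same value have the same values at all other members. -/
theorem eq_of_gate_eq (X : G.IsExtremal k d c f) (g : G.Gate e₁ x₁ e₂ x₂) (hne : x₁ ≠ x₂)
    (heq : f x₁ = f x₂) (hpos : 0 < f x₁)
    {y₁ y₂ : V} (hy₁ : y₁ ∈ e₁) (hy₁' : y₁ ≠ x₁) (hy₂ : y₂ ∈ e₂) (hy₂' : y₂ ≠ x₂) :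
    f y₁ = f y₂ := by
  obtain ⟨T₁, hT₁⟩ : ∃ T, ∑ v ∈ e₁, f v = f x₁ + T := ⟨∑ v ∈ e₁, f v - f x₁, by ring⟩
  obtain ⟨T₂, hT₂⟩ : ∃ T, ∑ v ∈ e₂, f v = f x₂ + T := ⟨∑ v ∈ e₂, f v - f x₂, by ring⟩
  -- With equal gate values the gate swap is neutral, so rigidity equates the remaining sums. The
  -- member swap then yields `-(f y₁ - f y₂) ^ 2 ≥ 0`.
  have hT := ((X.swap_gates g hne hT₁ hT₂).2 (by rw [heq]; ring)).1 hpos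
  have c1 := (X.swap_members g hy₁ hy₁' hy₂ hy₂' (b₁ := ∑ v ∈ e₁, f v - f y₁)
    (b₂ := ∑ v ∈ e₂, f v - f y₂) (by ring) (by ring)).1
  rw [hT₁, hT₂, hT, heq] at c1
  nlinarith [sq_nonneg (f y₁ - f y₂)]

/-- Edges that meet are ordered by their sums. -/
theorem le_of_sum_le (X : G.IsExtremal k d c f) {x : V} (g : G.Gate e₁ x e₂ x)
    (hle : ∑ v ∈ e₁, f v ≤ ∑ v ∈ e₂, f v)
    {y₁ y₂ : V} (hy₁ : y₁ ∈ e₁) (hy₁' : y₁ ≠ x) (hy₂ : y₂ ∈ e₂) (hy₂' : y₂ ≠ x) :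
    f y₁ ≤ f y₂ := by
  by_contra hlt
  rw [not_le] at hlt
  have c1 := (X.swap_members g hy₁ hy₁' hy₂ hy₂' (b₁ := ∑ v ∈ e₁, f v - f y₁)
    (b₂ := ∑ v ∈ e₂, f v - f y₂) (by ring) (by ring)).1
  nlinarith

end IsExtremal

end Extremal

/-! ### The ground state decreases away from its maximum -/

section Monotone

variable {V : Type*} [DecidableEq V] {G : FinHypergraph V} {k d : ℕ} {c : ℝ} {f : V → ℝ}
  {r : V} {h : V → ℕ} {top : Finset V → V} {pe : V → Finset V}

theorem Rooted.gate_of_eq (R : G.Rooted r h top pe) {e₁ e₂ : Finset V} (h₁ : e₁ ∈ G.edges)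
    (h₂ : e₂ ∈ G.edges) (hne : e₁ ≠ e₂) (heq : h (top e₁) = h (top e₂)) :
    G.Gate e₁ (top e₁) e₂ (top e₂) := by
  refine ⟨h₁, h₂, hne, R.top_mem _ h₁, R.top_mem _ h₂, ?_⟩
  have key : ∀ v, h v = h (top e₁) → (link ((G.edges.erase e₁).erase e₂)).Reachable v r := by
    intro v hv
    refine reachable_mono (fun e he => ?_) (R.reachable_root v)
    rw [Finset.mem_filter] at he
    refine Finset.mem_erase.2 ⟨?_, Finset.mem_erase.2 ⟨?_, he.1⟩⟩ <;> rintro rfl <;> omega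
  exact (key _ rfl).trans (key _ heq.symm).symm

/-- From `top e₂` one climbs a single parent edge, which is not `e₁` by `hmem`. From there on, both
tops reach the root by edges that start higher up. -/
theorem Rooted.gate_of_eq_succ (R : G.Rooted r h top pe) {e₁ e₂ : Finset V} (h₁ : e₁ ∈ G.edges)
    (h₂ : e₂ ∈ G.edges) (heq : h (top e₂) = h (top e₁) + 1) (hmem : top e₂ ∉ e₁) :
    G.Gate e₁ (top e₁) e₂ (top e₂) := by
  refine ⟨h₁, h₂, ?_, R.top_mem _ h₁, R.top_mem _ h₂, ?_⟩
  · rintro rfl; omega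
  have key : ∀ v, h v = h (top e₁) → (link ((G.edges.erase e₁).erase e₂)).Reachable v r := by
    intro v hv
    refine reachable_mono (fun e he => ?_) (R.reachable_root v)
    rw [Finset.mem_filter] at he
    refine Finset.mem_erase.2 ⟨?_, Finset.mem_erase.2 ⟨?_, he.1⟩⟩ <;> rintro rfl <;> omega
  have hr : top e₂ ≠ r := by
    intro hh
    have := (R.h_eq_zero _).2 hh
    omega
  have hp := R.h_pe hr
  have hin : pe (top e₂) ∈ (G.edges.erase e₁).erase e₂ := by
    refine Finset.mem_erase.2 ⟨?_, Finset.mem_erase.2 ⟨?_, R.pe_mem _ hr⟩⟩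
    · intro hh
      rw [hh] at hp
      omega
    · intro hh
      exact hmem (hh ▸ R.mem_pe _ hr)
  exact (key _ rfl).trans
    ((reachable_of_mem hin (R.mem_pe _ hr) (R.top_pe_mem hr)).trans (key _ (by omega))).symm

theorem Rooted.isInterior_top (R : G.Rooted r h top pe) (hr : G.IsInterior r)
    {e : Finset V} (he : e ∈ G.edges) :
    G.IsInterior (top e) := by
  by_cases htr : top e = r
  · rwa [htr]
  · refine isInterior_of_two_edges he (R.pe_mem _ htr) (R.top_mem e he) (R.mem_pe _ htr) ?_
    intro hh
    have := R.ne_top _ htr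
    rw [← hh] at this
    exact this rfl

variable [Fintype V]

namespace IsExtremal

theorem exists_top_eq (X : G.IsExtremal k d c f) (R : G.Rooted r h top pe) {v : V} (hv : 0 < f v) :
    ∃ e ∈ G.edges, top e = v := by
  obtain ⟨e, he, hve, hne⟩ := exists_edge_ne (X.two_le_degree_of_pos hv) (pe v)
  exact ⟨e, he, (R.eq_top_of_ne he hve hne).symm⟩

theorem exists_mem_ne (X : G.IsExtremal k d c f) {e : Finset V} (he : e ∈ G.edges) (v : V) :
    ∃ w ∈ e, w ≠ v :=
  Finset.exists_mem_ne (by rw [X.uniform e he]; exact X.two_le) v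

theorem pos_root (X : G.IsExtremal k d c f) (hmax : ∀ v, f v ≤ f r) : 0 < f r := by
  obtain ⟨v, hv⟩ := X.exists_interior
  exact (X.ground.pos v hv).trans_le (hmax v)

theorem pos_top (X : G.IsExtremal k d c f) (R : G.Rooted r h top pe) (hmax : ∀ v, f v ≤ f r)
    {e : Finset V} (he : e ∈ G.edges) : 0 < f (top e) := by
  exact X.interior_iff.1 (R.isInterior_top (X.interior_iff.2 (X.pos_root hmax)) he)

/-- If `f u < f w`, the path is prolonged at both ends, to the parent of `u` and to a child of `w`.
By `lt_of_gate_lt` the child has the larger value, against the induction hypothesis; the induction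
ends at the root, a maximum. -/
theorem le_of_reachable (X : G.IsExtremal k d c f) (R : G.Rooted r h top pe)
    (hmax : ∀ v, f v ≤ f r) (u w : V) (hle : h u ≤ h w)
    (hr : (link (G.edges.filter fun e => h u ≤ h (top e) ∧ h (top e) < h w)).Reachable u w) :
    f w ≤ f u := by
  induction hm : h u generalizing u w with
  | zero => rw [(R.h_eq_zero u).1 hm]; exact hmax w
  | succ m ih =>
    by_contra hlt
    rw [not_le] at hlt
    have hur : u ≠ r := by
      intro hh
      rw [(R.h_eq_zero u).2 hh] at hm
      omega
    obtain ⟨e₂, he₂, rfl⟩ := X.exists_top_eq R ((X.nonneg u).trans_lt hlt)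
    have hp := R.h_pe hur
    have hsub : G.edges.filter (fun e => h u ≤ h (top e) ∧ h (top e) < h (top e₂)) ⊆
        (G.edges.erase (pe u)).erase e₂ := by
      intro e he
      rw [Finset.mem_filter] at he
      refine Finset.mem_erase.2 ⟨?_, Finset.mem_erase.2 ⟨?_, he.1⟩⟩ <;> rintro rfl <;> omega
    have g : G.Gate (pe u) u e₂ (top e₂) := by
      refine ⟨R.pe_mem u hur, he₂, ?_, R.mem_pe u hur, R.top_mem _ he₂, reachable_mono hsub hr⟩
      rintro rfl
      omega
    obtain ⟨y, hy, hyt⟩ := X.exists_mem_ne he₂ (top e₂)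
    have hhy := R.h_of_mem e₂ he₂ y hy hyt
    have hlt' := X.lt_of_gate_lt g hlt (R.top_pe_mem hur) (R.ne_top u hur).symm hy hyt
      (X.pos_top R hmax (R.pe_mem u hur))
    refine absurd (ih (top (pe u)) y (by omega) ?_ (by omega)) (not_le.2 hlt')
    refine (reachable_of_mem (e := pe u) (Finset.mem_filter.2 ⟨R.pe_mem u hur, le_rfl, by omega⟩)
      (R.top_pe_mem hur) (R.mem_pe u hur)).trans (SimpleGraph.Reachable.trans ?_
      (reachable_of_mem (e := e₂) (Finset.mem_filter.2 ⟨he₂, by omega, by omega⟩)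
      (R.top_mem _ he₂) hy))
    refine reachable_mono (fun e he => ?_) hr
    rw [Finset.mem_filter] at he ⊢
    exact ⟨he.1, by omega, by omega⟩

theorem le_top_pe (X : G.IsExtremal k d c f) (R : G.Rooted r h top pe)
    (hmax : ∀ v, f v ≤ f r) {v : V} (hv : v ≠ r) : f v ≤ f (top (pe v)) := by
  have hp := R.h_pe hv
  refine X.le_of_reachable R hmax _ _ (by omega) ?_
  exact reachable_of_mem (Finset.mem_filter.2 ⟨R.pe_mem v hv, le_rfl, by omega⟩)
    (R.top_pe_mem hv) (R.mem_pe v hv)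

/-- Induction through the parents, which serve as gates of the parent edges. The exception is when
the parent of `w` lies in the parent edge of `u`, so that the two edges meet. -/
theorem le_of_h_eq_succ (X : G.IsExtremal k d c f) (R : G.Rooted r h top pe)
    (hmax : ∀ v, f v ≤ f r) (u w : V) (hh : h w = h u + 1) : f w ≤ f u := by
  induction hm : h u generalizing u w with
  | zero => rw [(R.h_eq_zero u).1 hm]; exact hmax w
  | succ m ih =>
    have hur : u ≠ r := fun h0 => by rw [(R.h_eq_zero u).2 h0] at hm; omega
    have hwr : w ≠ r := fun h0 => by rw [(R.h_eq_zero w).2 h0] at hh; omega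
    have hpu := R.h_pe hur
    have hpw := R.h_pe hwr
    have hu₁ := R.pe_mem u hur
    have hw₁ := R.pe_mem w hwr
    have hee : pe u ≠ pe w := fun h0 => by rw [h0] at hpu; omega
    by_cases hmem : top (pe w) ∈ pe u
    · by_cases hpu' : top (pe w) = u
      · rw [← hpu']; exact X.le_top_pe R hmax hwr
      have hpp : top (pe u) ≠ top (pe w) := fun h0 => by rw [h0] at hpu; omega
      by_contra hlt
      rw [not_le] at hlt
      have hwpos : 0 < f w := (X.nonneg u).trans_lt hlt
      have g : G.Gate (pe u) (top (pe w)) (pe w) (top (pe w)) :=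
        ⟨hu₁, hw₁, hee, hmem, R.top_mem _ hw₁, SimpleGraph.Reachable.refl _⟩
      -- The edges meet at the parent of `w`, so their sums decide. This bound and monotonicity
      -- along parents squeeze `f` to one value at `w`, its parent and the parent of `u`.
      have hpw_le : f (top (pe u)) ≤ f w := by
        rcases le_total (∑ v ∈ pe u, f v) (∑ v ∈ pe w, f v) with hs | hs
        · exact X.le_of_sum_le g hs (R.top_mem _ hu₁) hpp (R.mem_pe w hwr) (R.ne_top w hwr)
        · have := X.le_of_sum_le g.symm hs (R.mem_pe w hwr) (R.ne_top w hwr) (R.mem_pe u hur)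
            (Ne.symm hpu')
          linarith
      have h1 : f w ≤ f (top (pe w)) := X.le_top_pe R hmax hwr
      obtain ⟨hqr, hq⟩ := R.eq_pe _ hu₁ _ hmem hpp.symm
      have h2 : f (top (pe w)) ≤ f (top (pe u)) := by
        have := X.le_top_pe R hmax hqr
        rwa [← hq] at this
      -- An edge below `w` gives distinct gates with equal values. Then `u` and its parent both have
      -- the value of `y`, which contradicts `f u < f w`.
      obtain ⟨e₃, he₃, rfl⟩ := X.exists_top_eq R hwpos
      have g' : G.Gate (pe u) (top (pe (top e₃))) e₃ (top e₃) := by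
        refine ⟨hu₁, he₃, ?_, hmem, R.top_mem _ he₃, ?_⟩
        · rintro h0; rw [h0] at hpu; omega
        · refine reachable_of_mem (e := pe (top e₃)) ?_ (R.top_mem _ hw₁) (R.mem_pe _ hwr)
          refine Finset.mem_erase.2 ⟨fun h0 => ?_, Finset.mem_erase.2 ⟨hee.symm, hw₁⟩⟩
          rw [h0] at hpw; omega
      obtain ⟨y, hy, hyt⟩ := X.exists_mem_ne he₃ (top e₃)
      have hne' : top (pe (top e₃)) ≠ top e₃ := fun h0 => by rw [h0] at hpw; omega
      have hfe : f (top (pe (top e₃))) = f (top e₃) := by linarith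
      have hfp : 0 < f (top (pe (top e₃))) := by linarith
      have a1 := X.eq_of_gate_eq g' hne' hfe hfp (R.mem_pe u hur) (Ne.symm hpu') hy hyt
      have a2 := X.eq_of_gate_eq g' hne' hfe hfp (R.top_mem _ hu₁) hpp hy hyt
      linarith
    · have g := R.gate_of_eq_succ hu₁ hw₁ (by omega) hmem
      have hle := ih (top (pe u)) (top (pe w)) (by omega) (by omega)
      rcases hle.lt_or_eq with hlt | heq
      · exact X.le_of_gate_lt g.symm hlt (R.mem_pe w hwr) (R.ne_top w hwr) (R.mem_pe u hur)
          (R.ne_top u hur)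
      · refine (X.eq_of_gate_eq g (fun h0 => ?_) heq.symm (X.pos_top R hmax hu₁) (R.mem_pe u hur)
          (R.ne_top u hur) (R.mem_pe w hwr) (R.ne_top w hwr)).ge
        rw [h0] at hpu
        omega

theorem le_of_h_lt (X : G.IsExtremal k d c f) (R : G.Rooted r h top pe)
    (hmax : ∀ v, f v ≤ f r) (u w : V) (hh : h u < h w) : f w ≤ f u := by
  induction hm : h w generalizing w with
  | zero => omega
  | succ m ih =>
    have hwr : w ≠ r := fun h0 => by rw [(R.h_eq_zero w).2 h0] at hh; omega
    have hpw := R.h_pe hwr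
    rcases Nat.lt_or_ge (h u) (h (top (pe w))) with h1 | h1
    · exact (X.le_top_pe R hmax hwr).trans (ih _ h1 (by omega))
    · exact X.le_of_h_eq_succ R hmax u w (by omega)

end IsExtremal

end Monotone

/-! ### A spiral numbering along which the ground state decreases -/

section Code

/-- The rank counts the elements with larger value, scaled by `N`; an arbitrary enumeration below
`N` breaks the ties. -/
theorem exists_rank {α : Type*} [Finite α] (g : α → ℝ) :
    ∃ (rk : α → ℕ) (B : ℕ), Function.Injective rk ∧ (∀ a, rk a < B) ∧
      ∀ a b, rk a < rk b → g b ≤ g a := by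
  classical
  cases nonempty_fintype α
  let N := Fintype.card α
  let ι : α ≃ Fin N := Fintype.equivFin α
  let m : α → ℕ := fun a => (Finset.univ.filter fun b => g a < g b).card
  let rk : α → ℕ := fun a => m a * N + ι a
  obtain ⟨B, hB⟩ : ∃ B, ∀ a, rk a < B :=
    ⟨Finset.univ.sup rk + 1, fun a => Nat.lt_succ_of_le (Finset.le_sup (Finset.mem_univ a))⟩
  refine ⟨rk, B, fun a b hab => ?_, hB, fun a b hab => ?_⟩
  · have h1 : rk a % N = ι a := by
      simp only [rk, Nat.mul_add_mod_self_right]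
      exact Nat.mod_eq_of_lt (ι a).2
    have h2 : rk b % N = ι b := by
      simp only [rk, Nat.mul_add_mod_self_right]
      exact Nat.mod_eq_of_lt (ι b).2
    exact ι.injective (Fin.ext (by rw [← h1, ← h2, hab]))
  · by_contra hlt
    rw [not_le] at hlt
    have hm : m b < m a := by
      refine Finset.card_lt_card (Finset.ssubset_iff_of_subset ?_ |>.2 ⟨b, ?_, ?_⟩)
      · intro x hx
        simp only [Finset.mem_filter, Finset.mem_univ, true_and] at hx ⊢
        exact hlt.trans hx
      · simpa using hlt
      · simp
    have h1 : rk b < (m b + 1) * N := by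
      simp only [rk, add_mul, one_mul]
      have := (ι b).2
      omega
    have h2 : (m b + 1) * N ≤ m a * N := Nat.mul_le_mul_right _ hm
    have h3 : m a * N ≤ rk a := Nat.le_add_right _ _
    omega

theorem lex_of_digits_lt {B a b c a' b' c' : ℕ} (hb : b < B) (hc : c < B) (hb' : b' < B)
    (hc' : c' < B) (hlt : (a * B + b) * B + c < (a' * B + b') * B + c') :
    a < a' ∨ a = a' ∧ (b < b' ∨ b = b' ∧ c < c') := by
  have key : ∀ {p q s t : ℕ}, s < B → t < B → p * B + s < q * B + t → p < q ∨ p = q ∧ s < t := by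
    intro p q s t hs ht h
    rcases lt_trichotomy p q with h1 | h1 | h1
    · exact Or.inl h1
    · subst h1; exact Or.inr ⟨rfl, by omega⟩
    · have : (q + 1) * B ≤ p * B := Nat.mul_le_mul_right _ h1
      rw [add_mul, one_mul] at this
      omega
  rcases key hc hc' hlt with h1 | ⟨h1, h2⟩
  · rcases key hb hb' h1 with h3 | ⟨h3, h4⟩
    · exact Or.inl h3
    · exact Or.inr ⟨h3, Or.inl h4⟩
  · have h3 : a = a' := by
      have e1 : (a * B + b) / B = a := by
        rw [mul_comm, Nat.mul_add_div (by omega), Nat.div_eq_of_lt hb, add_zero]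
      have e2 : (a' * B + b') / B = a' := by
        rw [mul_comm, Nat.mul_add_div (by omega), Nat.div_eq_of_lt hb', add_zero]
      rw [← e1, ← e2, h1]
    subst h3
    exact Or.inr ⟨rfl, Or.inr ⟨by omega, h2⟩⟩

theorem digits_lt_of_lt {B a b c a' b' c' : ℕ} (hb : b < B) (hc : c < B) (hlt : a < a') :
    (a * B + b) * B + c < (a' * B + b') * B + c' := by
  have key : ∀ {p q s t : ℕ}, s < B → p < q → p * B + s < q * B + t := by
    intro p q s t hs h
    have : (p + 1) * B ≤ q * B := Nat.mul_le_mul_right _ h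
    rw [add_mul, one_mul] at this
    omega
  exact key hc (key hb hlt)

variable {V : Type*} [Fintype V] [DecidableEq V] {G : FinHypergraph V} {k d : ℕ} {c : ℝ}
  {f : V → ℝ} {r : V} {h : V → ℕ} {top : Finset V → V} {pe : V → Finset V}

/-- A numbering of the vertices in spiral order along which `f` is non-increasing. -/
structure IsSpiralCode (r : V) (h : V → ℕ) (top : Finset V → V)
    (pe : V → Finset V) (f : V → ℝ) (code : V → ℕ) : Prop where
  injective : Function.Injective code
  lt_of_h_lt : ∀ u v, h u < h v → code u < code v
  le_of_lt : ∀ u v, code u < code v → f v ≤ f u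
  children : ∀ u v, u ≠ r → v ≠ r → code (top (pe u)) < code (top (pe v)) → code u < code v
  pe_eq : ∀ u v w, u ≠ r → v ≠ r → w ≠ r → pe u = pe w → code u < code v → code v < code w →
    pe v = pe u

/-- In base `B`, the code appends to the code of the parent the rank of the parent edge by its sum
and the rank of the vertex by its value. Comparing codes at equal height is thus lexicographic. -/
theorem IsExtremal.exists_code (X : G.IsExtremal k d c f) (R : G.Rooted r h top pe)
    (hmax : ∀ v, f v ≤ f r) : ∃ code, IsSpiralCode r h top pe f code := by
  obtain ⟨rkE, B₁, injE, hB₁, monoE⟩ := exists_rank (fun e : Finset V => ∑ v ∈ e, f v)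
  obtain ⟨rkV, B₂, injV, hB₂, monoV⟩ := exists_rank f
  set B := max (max B₁ B₂) 2 with hB
  have hE : ∀ e, rkE e < B := fun e =>
    (hB₁ e).trans_le ((le_max_left _ _).trans (le_max_left _ _))
  have hV : ∀ v, rkV v < B := fun v =>
    (hB₂ v).trans_le ((le_max_right _ _).trans (le_max_left _ _))
  have hB2 : 2 ≤ B := le_max_right _ _
  -- The root gets `1`, not `0`: this leading digit puts the codes at height `m` into `[B ^ (2 * m),
  -- 2 * B ^ (2 * m))`, and as `2 ≤ B`, greater heights have greater codes.
  let aux : ℕ → V → ℕ := fun m => Nat.rec (fun _ => 1)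
    (fun _ prev v => (prev (top (pe v)) * B + rkE (pe v)) * B + rkV v) m
  let code : V → ℕ := fun v => aux (h v) v
  have code_eq : ∀ v, v ≠ r → code v = (code (top (pe v)) * B + rkE (pe v)) * B + rkV v := by
    intro v hv
    change aux (h v) v = (aux (h (top (pe v))) (top (pe v)) * B + _) * B + _
    rw [R.h_pe hv]
  have code_r : code r = 1 := by
    change aux (h r) r = 1
    rw [(R.h_eq_zero r).2 rfl]
    rfl
  have hbound : ∀ m v, h v = m → B ^ (2 * m) ≤ code v ∧ code v < 2 * B ^ (2 * m) := by
    intro m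
    induction m with
    | zero =>
      intro v hv
      rw [(R.h_eq_zero v).1 hv, code_r]
      simp
    | succ m ih =>
      intro v hv
      have hvr : v ≠ r := fun h0 => by rw [(R.h_eq_zero v).2 h0] at hv; omega
      obtain ⟨h1, h2⟩ := ih (top (pe v)) (by have := R.h_pe hvr; omega)
      have h3 := digits_lt_of_lt (b' := 0) (c' := 0) (hE (pe v)) (hV v) h2
      rw [← code_eq v hvr] at h3
      have h4 : code (top (pe v)) * B * B ≤ code v := by
        rw [code_eq v hvr]
        calc _ ≤ (code (top (pe v)) * B + rkE (pe v)) * B := Nat.mul_le_mul_right _ (by omega)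
          _ ≤ _ := by omega
      have h5 : B ^ (2 * (m + 1)) = B ^ (2 * m) * B * B := by ring
      rw [h5]
      refine ⟨(Nat.mul_le_mul_right _ (Nat.mul_le_mul_right _ h1)).trans h4, ?_⟩
      calc code v < _ := h3
        _ = _ := by ring
  have hh : ∀ u v, h u < h v → code u < code v := by
    intro u v huv
    have h1 := (hbound _ u rfl).2
    have h2 := (hbound _ v rfl).1
    have h3 : 2 * B ^ (2 * h u) ≤ B ^ (2 * h v) :=
      calc 2 * B ^ (2 * h u) ≤ B * B ^ (2 * h u) := Nat.mul_le_mul_right _ hB2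
        _ = B ^ (2 * h u + 1) := by ring
        _ ≤ _ := Nat.pow_le_pow_right (by omega) (by omega)
    omega
  have hinj : Function.Injective code := by
    intro u v huv
    by_cases hu : u = r
    · by_contra hne
      have := hh u v (by
        rw [(R.h_eq_zero u).2 hu]
        exact Nat.pos_of_ne_zero fun h0 => hne (hu.trans ((R.h_eq_zero v).1 h0).symm))
      omega
    by_cases hv : v = r
    · by_contra hne
      have := hh v u (by
        rw [(R.h_eq_zero v).2 hv]
        exact Nat.pos_of_ne_zero fun h0 => hu ((R.h_eq_zero u).1 h0))
      omega
    rw [code_eq u hu, code_eq v hv] at huv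
    have h1 := congrArg (· % B) huv
    simp only [Nat.mul_add_mod_self_right, Nat.mod_eq_of_lt (hV _)] at h1
    exact injV h1
  have hlex : ∀ u v, u ≠ r → v ≠ r → code u < code v → code (top (pe u)) < code (top (pe v)) ∨
      code (top (pe u)) = code (top (pe v)) ∧
        (rkE (pe u) < rkE (pe v) ∨ rkE (pe u) = rkE (pe v) ∧ rkV u < rkV v) := by
    intro u v hu hv huv
    rw [code_eq u hu, code_eq v hv] at huv
    exact lex_of_digits_lt (hE _) (hV _) (hE _) (hV _) huv
  refine ⟨code, hinj, hh, ?_, ?_, ?_⟩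
  · intro u v huv
    rcases lt_trichotomy (h u) (h v) with h1 | h1 | h1
    · exact X.le_of_h_lt R hmax u v h1
    · induction hm : h u generalizing u v with
      | zero =>
        rw [(R.h_eq_zero u).1 hm, (R.h_eq_zero v).1 (h1 ▸ hm)]
      | succ m ih =>
        have hur : u ≠ r := fun h0 => by rw [(R.h_eq_zero u).2 h0] at hm; omega
        have hvr : v ≠ r := fun h0 => by rw [(R.h_eq_zero v).2 h0] at h1; omega
        have hpu := R.h_pe hur
        have hpv := R.h_pe hvr
        have hu₁ := R.pe_mem u hur
        have hv₁ := R.pe_mem v hvr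
        -- Different parents are compared as gates, different edges at one parent by their sums, and
        -- members of one edge by their ranks.
        rcases hlex u v hur hvr huv with h2 | ⟨h2, h3 | ⟨-, h3⟩⟩
        · have hpe : pe u ≠ pe v := fun h0 => by rw [h0] at h2; omega
          have g := R.gate_of_eq hu₁ hv₁ hpe (by omega)
          rcases (ih _ _ h2 (by omega) (by omega)).lt_or_eq with h4 | h4
          · exact X.le_of_gate_lt g.symm h4 (R.mem_pe v hvr) (R.ne_top v hvr) (R.mem_pe u hur)
              (R.ne_top u hur)
          · refine (X.eq_of_gate_eq g (fun h0 => ?_) h4.symm (X.pos_top R hmax hu₁)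
              (R.mem_pe u hur) (R.ne_top u hur) (R.mem_pe v hvr) (R.ne_top v hvr)).ge
            rw [h0] at h2
            omega
        · have hpe : pe u ≠ pe v := fun h0 => by rw [h0] at h3; omega
          have g := R.gate_of_eq hu₁ hv₁ hpe (by omega)
          have htt : top (pe u) = top (pe v) := hinj h2
          rw [← htt] at g
          exact X.le_of_sum_le g.symm (monoE _ _ h3) (R.mem_pe v hvr)
            (by rw [htt]; exact R.ne_top v hvr) (R.mem_pe u hur) (R.ne_top u hur)
        · exact monoV u v h3
    · have := hh v u h1
      omega
  · intro u v hu hv huv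
    rw [code_eq u hu, code_eq v hv]
    exact digits_lt_of_lt (hE _) (hV _) huv
  · intro u v w hu hv hw huw h1 h2
    have a1 := hlex u v hu hv h1
    have a2 := hlex v w hv hw h2
    rw [← huw] at a2
    exact injE (by omega)

end Code

/-! ### Moving an edge, and the degrees of the interior vertices -/

section Shift

theorem Rooted.edge_consecutive {V : Type*} {G : FinHypergraph V} {f : V → ℝ} {r : V} {h : V → ℕ}
    {top : Finset V → V} {pe : V → Finset V} {code : V → ℕ} (R : G.Rooted r h top pe)
    (C : IsSpiralCode r h top pe f code) {e : Finset V} (he : e ∈ G.edges) {a b c v : V} (ha : a ∈ e) (hb : b ∈ e) (hc : c ∈ e)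
    (hab : code a < code b) (hbc : code b < code c) (hbv : code b < code v)
    (hvc : code v < code c) : v ∈ e := by
  have htop : ∀ w ∈ e, ∀ a ∈ e, code a < code w → w ≠ top e := by
    rintro w hw a ha haw rfl
    have hne : a ≠ top e := by rintro rfl; omega
    have := C.lt_of_h_lt (top e) a (by have := R.h_of_mem e he a ha hne; omega)
    omega
  obtain ⟨hbr, hpb⟩ := R.eq_pe e he b hb (htop b hb a ha hab)
  obtain ⟨hcr, hpc⟩ := R.eq_pe e he c hc (htop c hc b hb hbc)
  have hvr : v ≠ r := by
    rintro rfl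
    have := C.lt_of_h_lt v b (by
      rw [(R.h_eq_zero v).2 rfl]
      exact Nat.pos_of_ne_zero fun h0 => hbr ((R.h_eq_zero b).1 h0))
    omega
  have := C.pe_eq b v c hbr hvr hcr (by rw [← hpb, ← hpc]) hbv hvc
  rw [hpb, ← this]
  exact R.mem_pe v hvr

variable {V : Type*} [Fintype V] [DecidableEq V] {G : FinHypergraph V} {k d : ℕ} {c : ℝ}
  {f : V → ℝ}

/-- Moving an edge `e` from `u` to a vertex `v` of smaller value, if no other member of `e` has a
larger value than `v`. -/
theorem IsExtremal.shift (X : G.IsExtremal k d c f) {e : Finset V} (he : e ∈ G.edges) {u v : V}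
    (hu : u ∈ e) (hv : v ∉ e) (hr : (link (G.edges.erase e)).Reachable u v)
    (hdu : d < G.degree u) (hvpos : 0 < f v) (huv : f v ≤ f u)
    (hle : ∀ w ∈ e, w ≠ u → f w ≤ f v) : ∀ w ∈ e, f w = f u := by
  have huv' : u ≠ v := by rintro rfl; exact hv hu
  have hupos : 0 < f u := hvpos.trans_le huv
  set e' := insert v (e.erase u) with he'
  have n₁ : v ∉ e.erase u := fun hh => hv (Finset.mem_of_mem_erase hh)
  let H : FinHypergraph V := ⟨insert e' (G.edges.erase e), by
    intro e₁ h₁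
    rcases Finset.mem_insert.1 h₁ with rfl | h₁
    · exact ⟨v, Finset.mem_insert_self _ _⟩
    · exact G.nonempty_of_mem _ (Finset.mem_of_mem_erase h₁)⟩
  have hHE : H.edges = insert e' (G.edges.erase e) := rfl
  have hHu : H.IsUniform k := by
    intro e₁ h₁
    rcases Finset.mem_insert.1 h₁ with rfl | h₁
    · rw [he', Finset.card_insert_of_notMem n₁, Finset.card_erase_add_one hu, X.uniform e he]
    · exact X.uniform _ (Finset.mem_of_mem_erase h₁)
  have hcr := Finset.card_erase_add_one he
  have hHle : H.edges.card ≤ G.edges.card := by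
    have := Finset.card_insert_le e' (G.edges.erase e)
    rw [hHE]; omega
  have hsub : G.edges.erase e ⊆ H.edges := Finset.subset_insert _ _
  have q : ∀ w ∈ e, (link H.edges).Reachable w v := by
    intro w hw
    by_cases hwu : w = u
    · subst hwu; exact reachable_mono hsub hr
    · exact reachable_of_mem (Finset.mem_insert_self _ _)
        (Finset.mem_insert_of_mem (Finset.mem_erase.2 ⟨hwu, hw⟩)) (Finset.mem_insert_self _ _)
  obtain ⟨hHs, hHc⟩ := X.supertree.of_reachable X.two_le X.uniform hHu hHle (by
    intro e₁ h₁ x hx y hy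
    by_cases hee : e₁ = e
    · subst hee; exact (q x hx).trans (q y hy).symm
    · exact reachable_of_mem (hsub (Finset.mem_erase.2 ⟨hee, h₁⟩)) hx hy)
  have u₁ : e' ∉ G.edges.erase e := by
    intro hh
    rw [hHE, Finset.insert_eq_of_mem hh] at hHc
    omega
  have sumG : ∀ {M : Type} [AddCommMonoid M] (φ : Finset V → M),
      ∑ e ∈ G.edges, φ e = φ e + ∑ e ∈ G.edges.erase e, φ e := by
    intro M _ φ
    rw [← Finset.add_sum_erase _ _ he]
  have sumH : ∀ {M : Type} [AddCommMonoid M] (φ : Finset V → M),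
      ∑ e ∈ H.edges, φ e = φ e' + ∑ e ∈ G.edges.erase e, φ e := by
    intro M _ φ
    rw [hHE, Finset.sum_insert u₁]
  have s₁ : ∀ g : V → ℝ, ∑ w ∈ e', g w = ∑ w ∈ e, g w - g u + g v := by
    intro g
    rw [he', Finset.sum_insert n₁, ← Finset.add_sum_erase e g hu]; ring
  have i₁ : ∀ w, w ∈ e' ↔ w = v ∨ (w ≠ u ∧ w ∈ e) := fun w => by
    rw [he', Finset.mem_insert, Finset.mem_erase]
  have hdegu : H.degree u + 1 = G.degree u := by
    rw [degree_eq_sum, degree_eq_sum, sumH, sumG, if_pos hu, if_neg (by simp [i₁, huv'])]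
    omega
  have hdegv : H.degree v = G.degree v + 1 := by
    rw [degree_eq_sum, degree_eq_sum, sumH, sumG, if_neg hv, if_pos (by simp [i₁])]
    omega
  have hdeg : ∀ w, w ≠ u → w ≠ v → H.degree w = G.degree w := by
    intro w hwu hwv
    rw [degree_eq_sum, degree_eq_sum, sumH, sumG]
    simp [i₁, hwu, hwv]
  have hd2 := X.two_le_degree
  have hdv := X.le_degree v (X.interior_iff.2 hvpos)
  have hbd : ∀ w, H.IsBoundary w ↔ G.IsBoundary w := by
    intro w
    rw [IsBoundary, IsBoundary]
    by_cases hwu : w = u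
    · subst hwu; omega
    by_cases hwv : w = v
    · subst hwv; omega
    rw [hdeg w hwu hwv]
  have hdH : ∀ w, G.IsInterior w → d ≤ H.degree w := by
    intro w hw
    have := X.le_degree w hw
    by_cases hwu : w = u
    · subst hwu; omega
    by_cases hwv : w = v
    · subst hwv; omega
    rwa [hdeg w hwu hwv]
  have hT : ∑ w ∈ e.erase u, f w ≤ ((k : ℝ) - 1) * f v := by
    have h1 : ∑ w ∈ e.erase u, f w ≤ (e.erase u).card • f v :=
      Finset.sum_le_card_nsmul _ _ _ fun w hw =>
        hle w (Finset.mem_of_mem_erase hw) (Finset.ne_of_mem_erase hw)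
    have h2 : ((e.erase u).card : ℝ) = (k : ℝ) - 1 := by
      have := Finset.card_erase_add_one hu
      rw [X.uniform e he] at this
      rw [← this]; push_cast; ring
    rwa [nsmul_eq_mul, h2] at h1
  have hS := Finset.add_sum_erase e f hu
  have hk1 : (0 : ℝ) ≤ (k : ℝ) - 1 := by
    have : (2 : ℝ) ≤ k := by exact_mod_cast X.two_le
    linarith
  -- With `T` the sum over `e.erase u`, the form drops by `(f u - f v) * ((k - 1) * (f u + f v) - 2
  -- * T)`, and `T ≤ (k - 1) * f v ≤ (k - 1) * f u`.
  have hen : H.energy k f ≤ G.energy k f := by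
    rw [energy, energy, sumH, sumG]
    have a1 := s₁ (fun v => f v ^ 2)
    rw [s₁ f, a1, ← hS]
    have h1 : 0 ≤ (f u - f v) * (((k : ℝ) - 1) * (f u + f v) - 2 * ∑ w ∈ e.erase u, f w) := by
      refine mul_nonneg (by linarith) ?_
      have : 0 ≤ ((k : ℝ) - 1) * (f u - f v) := mul_nonneg hk1 (by linarith)
      linarith
    linarith
  -- By rigidity the contribution of the removed edge to the Laplacian at `u` is zero; it is a sum
  -- of non-negative differences.
  have hlap := (X.scaledLap_eq hHu hHs hbd hdH hen).1 u hupos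
  rw [scaledLap, scaledLap, Finset.sum_filter, Finset.sum_filter, sumH, sumG, if_pos hu,
    if_neg (by simp [i₁, huv'])] at hlap
  have hz : ∑ w ∈ e, (f u - f w) = 0 := by
    rw [Finset.sum_sub_distrib, Finset.sum_const, X.uniform e he, nsmul_eq_mul]
    linarith
  intro w hw
  have := (Finset.sum_eq_zero_iff_of_nonneg (fun w hw => by
    by_cases hwu : w = u
    · rw [hwu, sub_self]
    · have := hle w hw hwu
      linarith)).1 hz w hw
  linarith

variable {r : V} {h : V → ℕ} {top : Finset V → V} {pe : V → Finset V} {code : V → ℕ}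

/-- If `u` had a spare edge, the edge of its last child could be moved to the next interior vertex.
By `shift` that child then has the value `f u`, so no neighbour of `u` has a smaller value and the
Laplacian at `u` is not positive. -/
theorem IsExtremal.degree_eq_of_lt (X : G.IsExtremal k d c f) (R : G.Rooted r h top pe)
    (C : IsSpiralCode r h top pe f code) {u v : V} (hu : G.IsInterior u) (hv : G.IsInterior v)
    (huv : code u < code v) : G.degree u = d := by
  -- The given vertex is replaced by the interior vertex directly following `u`; then no child of
  -- `u` comes before `v`, as `shift` needs.
  obtain ⟨v, hvS, hmin⟩ :=
    (Finset.univ.filter fun w => G.IsInterior w ∧ code u < code w).exists_min_image code ⟨v, by simp [hv, huv]⟩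
  simp only [Finset.mem_filter, Finset.mem_univ, true_and] at hvS hmin
  replace hv := hvS.1
  replace huv := hvS.2
  by_contra hne
  have hdu : d < G.degree u := lt_of_le_of_ne (X.le_degree u hu) (Ne.symm hne)
  have hd2 := X.two_le_degree
  have hupos := X.interior_iff.1 hu
  have hvpos := X.interior_iff.1 hv
  have child_h : ∀ y, y ≠ r → top (pe y) = u → h y = h u + 1 := fun y hy hyu => by
    rw [← hyu]; exact R.h_pe hy
  have child_le : ∀ y, y ≠ r → top (pe y) = u → code v ≤ code y := by
    intro y hy hyu
    by_contra hlt
    rw [not_le] at hlt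
    have h1 := C.le_of_lt y v hlt
    have h2 := hmin y ⟨X.interior_iff.2 (hvpos.trans_le h1),
      C.lt_of_h_lt u y (by rw [child_h y hy hyu]; omega)⟩
    omega
  have child_of : ∀ e ∈ G.edges, top e = u → ∀ w ∈ e, w ≠ u → w ≠ r ∧ pe w = e := by
    intro e he heu w hw hwu
    obtain ⟨h1, h2⟩ := R.eq_pe e he w hw (by rwa [heu])
    exact ⟨h1, h2.symm⟩
  obtain ⟨e₀, he₀, he₀u⟩ := X.exists_top_eq R hupos
  obtain ⟨y₀, hy₀, hy₀u⟩ := X.exists_mem_ne he₀ u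
  obtain ⟨hy₀r, hpy₀⟩ := child_of e₀ he₀ he₀u y₀ hy₀ hy₀u
  obtain ⟨w₀, hw₀S, hmax⟩ :=
    (Finset.univ.filter fun w => w ≠ r ∧ top (pe w) = u).exists_max_image
    code ⟨y₀, by simp [hy₀r, hpy₀, he₀u]⟩
  simp only [Finset.mem_filter, Finset.mem_univ, true_and] at hw₀S hmax
  obtain ⟨hw₀r, hw₀u⟩ := hw₀S
  have he := R.pe_mem w₀ hw₀r
  have hue : u ∈ pe w₀ := hw₀u ▸ R.top_pe_mem hw₀r
  -- As `2 ≤ d < G.degree u`, there is a third edge at `u`. Its child `y` bounds the height of `v`,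
  -- and by consecutiveness keeps `v` out of the edge to be moved.
  obtain ⟨e₁, he₁, hne₁⟩ : ∃ e₁ ∈ G.edges.filter (fun e => u ∈ e),
      e₁ ∉ ({pe u, pe w₀} : Finset (Finset V)) := by
    refine Finset.exists_mem_notMem_of_card_lt_card ?_
    have h1 := Finset.card_le_two (a := pe u) (b := pe w₀)
    have h2 : (G.edges.filter fun e => u ∈ e).card = G.degree u := rfl
    omega
  rw [Finset.mem_filter] at he₁
  simp only [Finset.mem_insert, Finset.mem_singleton, not_or] at hne₁
  have he₁u : top e₁ = u := (R.eq_top_of_ne he₁.1 he₁.2 hne₁.1).symm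
  obtain ⟨y, hy, hyu⟩ := X.exists_mem_ne he₁.1 u
  obtain ⟨hyr, hpy⟩ := child_of e₁ he₁.1 he₁u y hy hyu
  have hyu' : top (pe y) = u := by rw [hpy, he₁u]
  have hvy := child_le y hyr hyu'
  have hvu : v ≠ u := by rintro rfl; omega
  have hve : v ∉ pe w₀ := by
    intro hve
    have hpv := (child_of _ he hw₀u v hve hvu).2
    have h1 : code v < code y := lt_of_le_of_ne hvy fun h0 => by
      rw [C.injective h0, hpy] at hpv
      exact hne₁.2 hpv
    have h2 : code y < code w₀ := lt_of_le_of_ne (hmax y ⟨hyr, hyu'⟩) fun h0 => by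
      rw [C.injective h0] at hpy
      exact hne₁.2 hpy.symm
    have h3 := R.edge_consecutive C he hue hve (R.mem_pe w₀ hw₀r) huv (h1.trans h2) h1 h2
    have h4 := (child_of _ he hw₀u y h3 hyu).2
    exact hne₁.2 (hpy.symm.trans h4)
  have hhv : h v ≤ h u + 1 := by
    by_contra hlt
    have := C.lt_of_h_lt y v (by rw [child_h y hyr hyu']; omega)
    omega
  have low : ∀ x, h x ≤ h u → (link (G.edges.erase (pe w₀))).Reachable x r := by
    intro x hx
    refine reachable_mono (fun e' he' => ?_) (R.reachable_root x)
    rw [Finset.mem_filter] at he'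
    refine Finset.mem_erase.2 ⟨?_, he'.1⟩
    rintro rfl
    rw [hw₀u] at he'
    omega
  have hreach : (link (G.edges.erase (pe w₀))).Reachable v r := by
    rcases Nat.lt_or_ge (h u) (h v) with h1 | h1
    · have hvr : v ≠ r := fun h0 => by rw [(R.h_eq_zero v).2 h0] at h1; omega
      refine (reachable_of_mem (e := pe v) (Finset.mem_erase.2 ⟨fun h0 => ?_, R.pe_mem v hvr⟩)
        (R.mem_pe v hvr) (R.top_pe_mem hvr)).trans (low _ ?_)
      · exact hve (h0 ▸ R.mem_pe v hvr)
      · have := R.h_pe hvr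
        omega
    · exact low v h1
  have hconst := X.shift he hue hve ((low u le_rfl).trans hreach.symm) hdu hvpos
    (C.le_of_lt u v huv) (by
      intro w hw hwu
      obtain ⟨hwr, hpw⟩ := child_of _ he hw₀u w hw hwu
      rcases (child_le w hwr (by rw [hpw, hw₀u])).lt_or_eq with h1 | h1
      · exact C.le_of_lt v w h1
      · rw [C.injective h1]) w₀ (R.mem_pe w₀ hw₀r)
  have hlap := X.ground.eigen u hu
  rw [scaledLap_eq_sum X.uniform] at hlap
  have hnonpos : ∑ e ∈ G.edges with u ∈ e, ∑ w ∈ e, (f u - f w) ≤ 0 := by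
    refine Finset.sum_nonpos fun e he => Finset.sum_nonpos fun w hw => ?_
    rw [Finset.mem_filter] at he
    rw [← hconst]
    have key : code w < code w₀ → f w₀ - f w ≤ 0 := fun hlt => by
      have := C.le_of_lt w w₀ hlt
      linarith
    have hw₀h := child_h w₀ hw₀r hw₀u
    by_cases htu : u = top e
    · by_cases hwu : w = u
      · rw [hwu, hconst, sub_self]
      · obtain ⟨hwr, hpw⟩ := child_of e he.1 htu.symm w hw hwu
        rcases (hmax w ⟨hwr, by rw [hpw, ← htu]⟩).lt_or_eq with h1 | h1
        · exact key h1
        · rw [C.injective h1, sub_self]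
    · refine key (C.lt_of_h_lt _ _ ?_)
      have h1 := R.h_of_mem e he.1 u he.2 htu
      by_cases hwt : w = top e
      · rw [hwt]; omega
      · have := R.h_of_mem e he.1 w hw hwt
        omega
  rw [hlap] at hnonpos
  have := mul_pos X.eigenvalue_pos hupos
  linarith

theorem IsExtremal.hasSLOrdering (X : G.IsExtremal k d c f) :
    G.HasSLOrdering ∧ G.AtMostOneInteriorDegreeGT d := by
  obtain ⟨v₀, -⟩ := X.exists_interior
  have : Nonempty V := ⟨v₀⟩
  obtain ⟨r, hmax⟩ := Finite.exists_max f
  obtain ⟨h, top, pe, R⟩ := X.supertree.exists_rooted r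
  obtain ⟨code, C⟩ := X.exists_code R hmax
  refine ⟨⟨r, fun u v => code u < code v, ?_, ?_, ?_, ?_, ?_, ?_⟩, ?_, ?_⟩
  · exact RelEmbedding.isWellOrder
      (⟨⟨code, C.injective⟩, Iff.rfl⟩ : (fun u v : V => code u < code v) ↪r ((· < ·) : ℕ → ℕ → Prop))
  · intro u v huv
    rw [← R.h_eq, ← R.h_eq]
    by_contra hlt
    have := C.lt_of_h_lt v u (by omega)
    omega
  · intro u v u₁ v₁ hu hv huv
    rw [R.isParent_iff] at hu hv
    obtain ⟨hu, rfl⟩ := hu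
    obtain ⟨hv, rfl⟩ := hv
    exact C.children u₁ v₁ hu hv huv
  · intro u v huv hu
    by_contra hv
    have h1 := C.le_of_lt u v huv
    rw [X.ground.zero u hu] at h1
    have := X.ground.pos v hv
    linarith
  · rintro e he a ha b hb c hc hab hbc ⟨v, hv, hbv, hvc⟩
    exact hv (R.edge_consecutive C he ha hb hc hab hbc hbv hvc)
  · intro u v hu hv huv
    rw [X.degree_eq_of_lt R C hu hv huv]
    exact X.le_degree v hv
  · refine Finset.card_le_one.2 fun a ha b hb => ?_
    simp only [Finset.mem_filter, Finset.mem_univ, true_and] at ha hb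
    rcases lt_trichotomy (code a) (code b) with h1 | h1 | h1
    · have := X.degree_eq_of_lt R C ha.1 hb.1 h1
      omega
    · exact C.injective h1
    · have := X.degree_eq_of_lt R C hb.1 ha.1 h1
      omega
  · intro v hv hd
    have := X.le_degree v hv
    omega

end Shift

/-! ### From the Faber–Krahn property to extremality -/

section FaberKrahn

/-- A competitor with the same boundary lies in the class, so its form is bounded below by its own,
no smaller, first eigenvalue. -/
theorem HasFaberKrahn.exists_isExtremal {k n n₀ d : ℕ} (hk : 2 ≤ k) (hn₀ : 1 ≤ n₀) (hd : 2 ≤ d)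
    {G : FinHypergraph (Fin n)} (hG : HasFaberKrahn (supertreesMinDegree k n n₀ d) G) :
    ∃ c f, G.IsExtremal k d c f := by
  obtain ⟨⟨⟨hu, hs, hcard⟩, hdeg⟩, hmin⟩ := hG
  have hint : ∃ v, G.IsInterior v := by
    obtain ⟨v, hv⟩ := Finset.card_pos.1 (by omega :
      0 < (Finset.univ.filter fun v => G.IsInterior v).card)
    exact ⟨v, (Finset.mem_filter.1 hv).2⟩
  obtain ⟨f, hf⟩ := exists_isGroundState hk hu hs.1 hint
  refine ⟨_, f, hk, hd, hu, hs, hf, hdeg, hint, fun H hHu hHs hb hHd g hg => ?_⟩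
  have hint' : ∀ v, H.IsInterior v ↔ G.IsInterior v := fun v => not_congr (hb v)
  have hle : G.firstDirichletEigenvalue ≤ H.firstDirichletEigenvalue := by
    refine hmin H ⟨⟨hHu, hHs, ?_⟩, fun v hv => hHd v ((hint' v).1 hv)⟩
    rw [← hcard]
    congr 1
    exact Finset.filter_congr fun v _ => hint' v
  obtain ⟨v, hv⟩ := hint
  obtain ⟨f', hf'⟩ := exists_isGroundState hk hHu hHs.1 ⟨v, (hint' v).2 hv⟩
  refine le_trans ?_ (hf'.le_energy g fun v hv => hg v ((hb v).1 hv))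
  have hk' : (0 : ℝ) ≤ (k : ℝ) - 1 := by
    have : (2 : ℝ) ≤ k := by exact_mod_cast hk
    linarith
  exact mul_le_mul_of_nonneg_right (mul_le_mul_of_nonneg_left hle hk')
    (Finset.sum_nonneg fun v _ => sq_nonneg _)

end FaberKrahn

/-! ### Blocks of siblings and their index -/

section Position

theorem Rooted.pos_root_lt {V : Type*} {G : FinHypergraph V} {r : V} {h : V → ℕ}
    {top : Finset V → V} {pe : V → Finset V} {f : V → ℝ} {pos : V → ℕ}
    (R : G.Rooted r h top pe) (C : IsSpiralCode r h top pe f pos)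
    {v : V} (hv : v ≠ r) : pos r < pos v := by
  refine C.lt_of_h_lt r v ?_
  rw [(R.h_eq_zero r).2 rfl]
  exact Nat.pos_of_ne_zero fun h0 => hv ((R.h_eq_zero v).1 h0)

variable {V : Type*} [DecidableEq V] {G : FinHypergraph V} {k : ℕ}
  {r : V} {h : V → ℕ} {top : Finset V → V} {pe : V → Finset V} {f : V → ℝ} {pos : V → ℕ}

/-- The edges, apart from the parent edge of `v`, that have a member other than the top vertex
before `v`. -/
def edgesBefore (G : FinHypergraph V) (top : Finset V → V) (pe : V → Finset V) (pos : V → ℕ)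
    (v : V) : Finset (Finset V) :=
  G.edges.filter fun e => e ≠ pe v ∧ ∃ w ∈ e, w ≠ top e ∧ pos w < pos v

/-- The number of edges whose top vertex is one of the first `i` vertices. -/
def topsBefore (G : FinHypergraph V) (top : Finset V → V) (pos : V → ℕ) (i : ℕ) : ℕ :=
  (G.edges.filter fun e => pos (top e) < i).card

namespace Rooted

theorem mem_edgesBefore (R : G.Rooted r h top pe) {v : V} {e : Finset V} :
    e ∈ G.edgesBefore top pe pos v ↔ e ≠ pe v ∧ ∃ w, w ≠ r ∧ pe w = e ∧ pos w < pos v := by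
  rw [edgesBefore, Finset.mem_filter]
  constructor
  · rintro ⟨he, hne, w, hw, hwt, hlt⟩
    obtain ⟨h1, h2⟩ := R.eq_pe e he w hw hwt
    exact ⟨hne, w, h1, h2.symm, hlt⟩
  · rintro ⟨hne, w, hwr, rfl, hlt⟩
    exact ⟨R.pe_mem w hwr, hne, w, R.mem_pe w hwr, R.ne_top w hwr, hlt⟩

theorem edgesBefore_subset (R : G.Rooted r h top pe) (C : IsSpiralCode r h top pe f pos)
    {u v : V} (hu : u ≠ r) (hv : v ≠ r)
    (huv : pe u = pe v ∨ pos u < pos v) :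
    G.edgesBefore top pe pos u ⊆ G.edgesBefore top pe pos v := by
  intro e he
  rw [R.mem_edgesBefore] at he ⊢
  obtain ⟨hne, w, hwr, rfl, hlt⟩ := he
  rcases huv with huv | huv
  · refine ⟨huv ▸ hne, w, hwr, rfl, ?_⟩
    by_contra hle
    rcases (not_lt.1 hle).lt_or_eq with h1 | h1
    · exact hne ((C.pe_eq v w u hv hwr hu huv.symm h1 hlt).trans huv.symm)
    · rw [C.injective h1] at huv
      exact hne huv.symm
  · refine ⟨fun h0 => hne ?_, w, hwr, rfl, hlt.trans huv⟩
    exact (C.pe_eq w u v hwr hu hv h0 hlt huv).symm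

theorem card_edgesBefore_lt (R : G.Rooted r h top pe) (C : IsSpiralCode r h top pe f pos)
    {u v : V} (hu : u ≠ r) (hv : v ≠ r) (hne : pe u ≠ pe v)
    (huv : pos u < pos v) :
    (G.edgesBefore top pe pos u).card < (G.edgesBefore top pe pos v).card := by
  refine Finset.card_lt_card (Finset.ssubset_iff_of_subset
    (R.edgesBefore_subset C hu hv (Or.inr huv)) |>.2 ⟨pe u, ?_, ?_⟩)
  · exact R.mem_edgesBefore.2 ⟨hne, u, hu, rfl, huv⟩
  · intro hh
    exact (R.mem_edgesBefore.1 hh).1 rfl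

/-- The number of earlier blocks identifies the parent edge, since it increases strictly when a new
edge is entered. -/
theorem pe_eq_iff (R : G.Rooted r h top pe) (C : IsSpiralCode r h top pe f pos)
    {u v : V} (hu : u ≠ r) (hv : v ≠ r) :
    pe u = pe v ↔ (G.edgesBefore top pe pos u).card = (G.edgesBefore top pe pos v).card := by
  constructor
  · intro huv
    rw [(R.edgesBefore_subset C hu hv (Or.inl huv)).antisymm
      (R.edgesBefore_subset C hv hu (Or.inl huv.symm))]
  · intro hcard
    by_contra hne
    rcases lt_trichotomy (pos u) (pos v) with h1 | h1 | h1
    · exact (R.card_edgesBefore_lt C hu hv hne h1).ne hcard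
    · exact hne (congrArg pe (C.injective h1))
    · exact (R.card_edgesBefore_lt C hv hu (Ne.symm hne) h1).ne hcard.symm

/-- Edges with an earlier top have all their children earlier. With `lt_topsBefore` this confines
the block index to an interval that determines the position of the parent. -/
theorem topsBefore_le (R : G.Rooted r h top pe) (C : IsSpiralCode r h top pe f pos)
    (hk : 2 ≤ k) (hu : G.IsUniform k) {v : V} (hv : v ≠ r) :
    G.topsBefore top pos (pos (top (pe v))) ≤ (G.edgesBefore top pe pos v).card := by
  refine Finset.card_le_card fun e he => ?_
  rw [Finset.mem_filter] at he
  obtain ⟨w, hw, hwt⟩ := Finset.exists_mem_ne (s := e) (by rw [hu e he.1]; omega) (top e)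
  obtain ⟨hwr, rfl⟩ := R.eq_pe e he.1 w hw hwt
  refine R.mem_edgesBefore.2 ⟨fun h0 => ?_, w, hwr, rfl, C.children w v hwr hv he.2⟩
  rw [h0] at he
  exact lt_irrefl _ he.2

theorem lt_topsBefore (R : G.Rooted r h top pe) (C : IsSpiralCode r h top pe f pos)
    {v : V} (hv : v ≠ r) :
    (G.edgesBefore top pe pos v).card < G.topsBefore top pos (pos (top (pe v)) + 1) := by
  refine Finset.card_lt_card (Finset.ssubset_iff_of_subset ?_ |>.2 ⟨pe v, ?_, ?_⟩)
  · intro e he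
    obtain ⟨hne, w, hwr, rfl, hlt⟩ := R.mem_edgesBefore.1 he
    refine Finset.mem_filter.2 ⟨R.pe_mem w hwr, ?_⟩
    by_contra hle
    have := C.children v w hv hwr (by omega)
    omega
  · exact Finset.mem_filter.2 ⟨R.pe_mem v hv, Nat.lt_succ_self _⟩
  · intro hh
    exact (R.mem_edgesBefore.1 hh).1 rfl

theorem card_top_eq (R : G.Rooted r h top pe) (v : V) :
    (G.edges.filter fun e => top e = v).card + (if v = r then 0 else 1) = G.degree v := by
  by_cases hv : v = r
  · rw [if_pos hv, add_zero, degree]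
    congr 1
    refine Finset.filter_congr fun e he => ?_
    constructor
    · rintro rfl; exact R.top_mem e he
    · intro hve
      by_contra hne
      exact (R.eq_pe e he v hve (Ne.symm hne)).1 hv
  · have hset : (G.edges.filter fun e => v ∈ e) =
        insert (pe v) (G.edges.filter fun e => top e = v) := by
      ext e
      rw [Finset.mem_insert, Finset.mem_filter, Finset.mem_filter]
      constructor
      · rintro ⟨he, hve⟩
        by_cases hp : e = pe v
        · exact Or.inl hp
        · exact Or.inr ⟨he, (R.eq_top_of_ne he hve hp).symm⟩
      · rintro (rfl | ⟨he, rfl⟩)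
        · exact ⟨R.pe_mem v hv, R.mem_pe v hv⟩
        · exact ⟨he, R.top_mem e he⟩
    rw [if_neg hv, degree, hset, Finset.card_insert_of_notMem]
    intro hh
    exact R.ne_top v hv (Finset.mem_filter.1 hh).2.symm

/-- Apart from the root, which accounts for the `- 1`, the vertices before `v` are `k - 1` children
for each earlier block and fewer than `k - 1` siblings of `v`. -/
theorem block_eq [Fintype V] (R : G.Rooted r h top pe) (C : IsSpiralCode r h top pe f pos)
    (hu : G.IsUniform k)
    (hpos : ∀ v, pos v = (Finset.univ.filter fun w => pos w < pos v).card) {v : V} (hv : v ≠ r) :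
    (pos v - 1) / (k - 1) = (G.edgesBefore top pe pos v).card := by
  set S := (Finset.univ.erase r).filter fun w => pos w < pos v with hS
  have hScard : S.card = pos v - 1 := by
    rw [hS, Finset.filter_erase, Finset.card_erase_of_mem, ← hpos]
    simpa using R.pos_root_lt C hv
  have hmaps : ∀ w ∈ S, pe w ∈ insert (pe v) (G.edgesBefore top pe pos v) := by
    intro w hw
    rw [hS, Finset.mem_filter, Finset.mem_erase] at hw
    rw [Finset.mem_insert, R.mem_edgesBefore]
    by_cases hwv : pe w = pe v
    · exact Or.inl hwv
    · exact Or.inr ⟨hwv, w, hw.1.1, rfl, hw.2⟩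
  have hsum := Finset.card_eq_sum_card_fiberwise hmaps
  rw [Finset.sum_insert (fun hh => (R.mem_edgesBefore.1 hh).1 rfl)] at hsum
  have hfib : ∀ e ∈ G.edgesBefore top pe pos v, (S.filter fun w => pe w = e).card = k - 1 := by
    intro e he
    obtain ⟨hne, w, hwr, rfl, hlt⟩ := R.mem_edgesBefore.1 he
    have hE := R.pe_mem w hwr
    rw [← hu _ hE, ← Finset.card_erase_of_mem (R.top_mem _ hE), ← R.filter_pe_eq hE, hS,
      Finset.filter_filter]
    congr 1
    refine Finset.filter_congr fun x hx => ?_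
    have hxr := Finset.ne_of_mem_erase hx
    refine ⟨fun hh => hh.2, fun hh => ⟨?_, hh⟩⟩
    by_contra hle
    rcases (not_lt.1 hle).lt_or_eq with h1 | h1
    · exact hne (C.pe_eq w v x hwr hv hxr hh.symm hlt h1).symm
    · rw [C.injective h1] at hne
      exact hne hh.symm
  have hlast : (S.filter fun w => pe w = pe v).card < k - 1 := by
    have hE := R.pe_mem v hv
    rw [← hu _ hE, ← Finset.card_erase_of_mem (R.top_mem _ hE), ← R.filter_pe_eq hE]
    refine Finset.card_lt_card (Finset.ssubset_iff_of_subset ?_ |>.2 ⟨v, ?_, ?_⟩)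
    · exact Finset.filter_subset_filter _ (Finset.filter_subset _ _)
    · simp [hv]
    · simp [hS]
  rw [Finset.sum_congr rfl hfib, Finset.sum_const, smul_eq_mul, hScard] at hsum
  rw [hsum, Nat.add_mul_div_right _ _ (by omega), Nat.div_eq_of_lt hlast, zero_add]

end Rooted

end Position

/-! ### Uniqueness of spiral supertrees -/

section Unique

variable {V : Type*} [Fintype V] [DecidableEq V]

/-- The number of edges whose top vertex is among the first `i` vertices, in a supertree with `m`
edges whose first `n₀` vertices are the interior ones and have, except the last one, degree `d`. -/
def spiralTops (n₀ d m i : ℕ) : ℕ :=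
  if i < n₀ then i * (d - 1) + (if i = 0 then 0 else 1) else m

/-- The positions of the vertices determine the parent edges and the parents. -/
structure IsSpiralPosition (G : FinHypergraph V) (k n₀ d : ℕ) (r : V) (top : Finset V → V)
    (pe : V → Finset V) (pos : V → ℕ) : Prop where
  rooted : ∃ h, G.Rooted r h top pe
  injective : Function.Injective pos
  lt_card : ∀ v, pos v < Fintype.card V
  pos_root : pos r = 0
  pe_eq_iff : ∀ u v, u ≠ r → v ≠ r →
    (pe u = pe v ↔ (pos u - 1) / (k - 1) = (pos v - 1) / (k - 1))
  le_block : ∀ v, v ≠ r →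
    spiralTops n₀ d G.edges.card (pos (top (pe v))) ≤ (pos v - 1) / (k - 1)
  block_lt : ∀ v, v ≠ r →
    (pos v - 1) / (k - 1) < spiralTops n₀ d G.edges.card (pos (top (pe v)) + 1)
  monotone : Monotone (spiralTops n₀ d G.edges.card)

theorem HasSLOrdering.exists_isSpiralPosition {G : FinHypergraph V} {k n₀ d : ℕ} (hk : 2 ≤ k)
    (hn₀ : 1 ≤ n₀) (hd : 2 ≤ d) (hu : G.IsUniform k) (hs : G.IsSupertree)
    (hcard : (Finset.univ.filter fun v => G.IsInterior v).card = n₀) (hO : G.HasSLOrdering)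
    (hD : G.AtMostOneInteriorDegreeGT d) :
    ∃ r top pe pos, G.IsSpiralPosition k n₀ d r top pe pos := by
  classical
  obtain ⟨r, lt, O⟩ := hO
  obtain ⟨h, top, pe, R⟩ := hs.exists_rooted r
  have := O.wellOrder
  let pos : V → ℕ := fun v => (Finset.univ.filter fun w => lt w v).card
  have irr : ∀ v, ¬ lt v v := fun v => irrefl v
  have tri : ∀ u v, lt u v ∨ u = v ∨ lt v u := fun u v => trichotomous u v
  have pos_lt : ∀ u v, lt u v → pos u < pos v := by
    intro u v huv
    refine Finset.card_lt_card (Finset.ssubset_iff_of_subset ?_ |>.2 ⟨u, by simpa, by simp [irr]⟩)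
    intro w hw
    simp only [Finset.mem_filter, Finset.mem_univ, true_and] at hw ⊢
    exact _root_.trans hw huv
  have pos_lt_iff : ∀ u v, pos u < pos v ↔ lt u v := by
    intro u v
    refine ⟨fun hlt => ?_, pos_lt u v⟩
    rcases tri u v with h1 | rfl | h1
    · exact h1
    · omega
    · have := pos_lt v u h1
      omega
  have hinj : Function.Injective pos := by
    intro u v huv
    rcases tri u v with h1 | h1 | h1
    · have := pos_lt u v h1; omega
    · exact h1
    · have := pos_lt v u h1; omega
  have hlt_of_h : ∀ u v, h u < h v → pos u < pos v := by
    intro u v huv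
    rw [pos_lt_iff]
    rcases tri u v with h1 | rfl | h1
    · exact h1
    · omega
    · have := O.height_le v u h1
      rw [← R.h_eq, ← R.h_eq] at this
      omega
  -- Only the combinatorial clauses matter here, so the function is taken to be zero.
  have C : IsSpiralCode r h top pe (fun _ => (0 : ℝ)) pos := by
    refine ⟨hinj, hlt_of_h, fun _ _ _ => le_rfl, ?_, ?_⟩
    · intro u v hur hvr huv
      rw [pos_lt_iff] at huv ⊢
      exact O.children _ _ u v (R.isParent_iff.2 ⟨hur, rfl⟩) (R.isParent_iff.2 ⟨hvr, rfl⟩) huv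
    · intro u v w hur hvr hwr huw h1 h2
      have hE := R.pe_mem u hur
      have htu : pos (top (pe u)) < pos u := hlt_of_h _ _ (by rw [R.h_pe hur]; omega)
      have hv : v ∈ pe u := by
        by_contra hv
        refine O.edge_consecutive (pe u) hE (top (pe u)) (R.top_mem _ hE) u (R.mem_pe u hur) w
          (huw ▸ R.mem_pe w hwr) ((pos_lt_iff _ _).1 htu) ((pos_lt_iff _ _).1 (h1.trans h2))
          ⟨v, hv, (pos_lt_iff _ _).1 h1, (pos_lt_iff _ _).1 h2⟩
      refine (R.eq_pe _ hE v hv fun h0 => ?_).2.symm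
      rw [← h0] at htu
      omega
  have hpos : ∀ v, pos v = (Finset.univ.filter fun w => pos w < pos v).card := by
    intro v
    simp only [pos_lt_iff]
    rfl
  have hltcard : ∀ v, pos v < Fintype.card V := by
    intro v
    rw [hpos, ← Finset.card_univ]
    refine Finset.card_lt_card (Finset.ssubset_iff_of_subset (Finset.subset_univ _) |>.2
      ⟨v, Finset.mem_univ _, by simp⟩)
  have hsurj : ∀ i < Fintype.card V, ∃ v, pos v = i := by
    intro i hi
    have hbij : Function.Bijective (fun v => (⟨pos v, hltcard v⟩ : Fin (Fintype.card V))) := by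
      rw [Fintype.bijective_iff_injective_and_card]
      exact ⟨fun u v huv => hinj (Fin.ext_iff.1 huv), by simp⟩
    obtain ⟨v, hv⟩ := hbij.2 ⟨i, hi⟩
    exact ⟨v, Fin.ext_iff.1 hv⟩
  have hposr : pos r = 0 := by
    rw [hpos, Finset.card_eq_zero, Finset.filter_eq_empty_iff]
    intro w _ hw
    by_cases hwr : w = r
    · rw [hwr] at hw; omega
    · have := R.pos_root_lt C hwr
      omega
  have hint : ∀ v, G.IsInterior v ↔ pos v < n₀ := by
    intro v
    rw [← hcard, hpos]
    constructor
    · intro hv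
      refine Finset.card_lt_card (Finset.ssubset_iff_of_subset ?_ |>.2 ⟨v, by simpa, by simp⟩)
      intro w hw
      simp only [Finset.mem_filter, Finset.mem_univ, true_and, pos_lt_iff] at hw ⊢
      exact fun hb => hv (O.boundary w v hw hb)
    · intro hlt
      by_contra hv
      refine absurd (Finset.card_le_card ?_) (not_le.2 hlt)
      intro w hw
      simp only [Finset.mem_filter, Finset.mem_univ, true_and, pos_lt_iff] at hw ⊢
      rcases tri w v with h1 | rfl | h1
      · exact h1
      · exact absurd hw hv
      · exact absurd (O.boundary v w h1 (not_not.1 hv)) hw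
  have hn₀le : n₀ ≤ Fintype.card V := by
    rw [← hcard, ← Finset.card_univ]
    exact Finset.card_le_card (Finset.filter_subset _ _)
  -- Degrees are non-decreasing, so a degree above `d` before the last interior vertex would occur
  -- there a second time.
  have hdeg : ∀ v, pos v + 1 < n₀ → G.degree v = d := by
    intro v hv
    obtain ⟨w, hw⟩ := hsurj (n₀ - 1) (by omega)
    have hvi := (hint v).2 (by omega)
    have hwi := (hint w).2 (by omega)
    refine hD.2 v hvi fun hlt => ?_
    have hle := O.degree_le v w hvi hwi ((pos_lt_iff v w).1 (by omega))
    have := Finset.card_le_one.1 hD.1 v (by simp [hvi, hlt]) w (by simp [hwi]; omega)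
    rw [this] at hv
    omega
  -- For `i < n₀` the last interior vertex, whose degree is not prescribed, is not among the first
  -- `i`. The root is the top of `d` edges, the others of `d - 1`, whence the extra `1`.
  have htops : ∀ i, G.topsBefore top pos i = spiralTops n₀ d G.edges.card i := by
    intro i
    rw [spiralTops]
    split_ifs with hi h0
    · subst h0; simp [topsBefore]
    · have key : ∀ j, j < n₀ → G.topsBefore top pos j = j * (d - 1) + (if j = 0 then 0 else 1) := by
        intro j
        induction j with
        | zero => intro _; simp [topsBefore]
        | succ j ih =>
          intro hj
          obtain ⟨v, hv⟩ := hsurj j (by omega)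
          have hsplit : G.topsBefore top pos (j + 1) =
              G.topsBefore top pos j + (G.edges.filter fun e => top e = v).card := by
            rw [topsBefore, topsBefore, ← Finset.card_union_of_disjoint]
            · congr 1
              rw [← Finset.filter_or]
              refine Finset.filter_congr fun e _ => ?_
              rw [Nat.lt_succ_iff_lt_or_eq, ← hv, hinj.eq_iff]
            · rw [Finset.disjoint_filter]
              rintro e _ h1 rfl
              omega
          have hvr : v = r ↔ j = 0 := by
            rw [← hinj.eq_iff, hv, hposr]
          have hc := R.card_top_eq v
          rw [hdeg v (by omega)] at hc
          rw [hsplit, ih (by omega)]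
          simp only [hvr] at hc
          rw [add_mul, one_mul, if_neg (Nat.succ_ne_zero j)]
          split_ifs at hc ⊢ <;> omega
      rw [key i hi, if_neg h0]
    · rw [topsBefore, Finset.filter_true_of_mem]
      intro e he
      have := (hint _).1 (R.isInterior_top ((hint r).2 (by omega)) he)
      omega
  refine ⟨r, top, pe, pos, ⟨h, R⟩, hinj, hltcard, hposr, ?_, ?_, ?_, ?_⟩
  · intro u v hur hvr
    rw [R.block_eq C hu hpos hur, R.block_eq C hu hpos hvr]
    exact R.pe_eq_iff C hur hvr
  · intro v hvr
    rw [R.block_eq C hu hpos hvr, ← htops]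
    exact R.topsBefore_le C hk hu hvr
  · intro v hvr
    rw [R.block_eq C hu hpos hvr, ← htops]
    exact R.lt_topsBefore C hvr
  · intro i j hij
    rw [← htops, ← htops]
    refine Finset.card_le_card fun e he => ?_
    rw [Finset.mem_filter] at he ⊢
    exact ⟨he.1, he.2.trans_le hij⟩

variable {G H : FinHypergraph V} {k n₀ d : ℕ} {r r' : V} {top top' : Finset V → V}
  {pe pe' : V → Finset V} {pos pos' : V → ℕ}

theorem IsSpiralPosition.map_mem (P : G.IsSpiralPosition k n₀ d r top pe pos)
    (P' : H.IsSpiralPosition k n₀ d r' top' pe' pos') (hk : 2 ≤ k) (hG : G.IsUniform k)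
    (hH : H.IsUniform k) (hE : G.edges.card = H.edges.card) (σ : V ≃ V)
    (hσ : ∀ v, pos' (σ v) = pos v) {e : Finset V} (he : e ∈ G.edges) :
    e.map σ.toEmbedding ∈ H.edges := by
  obtain ⟨h, R⟩ := P.rooted
  obtain ⟨h', R'⟩ := P'.rooted
  have hroot : ∀ v, v ≠ r → σ v ≠ r' := by
    intro v hv h0
    apply hv
    apply P.injective
    rw [← hσ, h0, P.pos_root, P'.pos_root]
  obtain ⟨b, hb, hbt⟩ := Finset.exists_mem_ne (s := e) (by rw [hG e he]; omega) (top e)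
  obtain ⟨hbr, rfl⟩ := R.eq_pe e he b hb hbt
  have hbr' := hroot b hbr
  have hE' := R'.pe_mem _ hbr'
  -- Both positions satisfy the same two inequalities for the same block index and the same monotone
  -- function, so they agree.
  have hparent : pos (top (pe b)) = pos' (top' (pe' (σ b))) := by
    have a1 := P.le_block b hbr
    have a2 := P.block_lt b hbr
    have b1 := P'.le_block _ hbr'
    have b2 := P'.block_lt _ hbr'
    rw [hσ, ← hE] at b1 b2
    rcases lt_trichotomy (pos (top (pe b))) (pos' (top' (pe' (σ b)))) with h1 | h1 | h1
    · have := P.monotone (Nat.succ_le_of_lt h1)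
      simp only [Nat.succ_eq_add_one] at this
      omega
    · exact h1
    · have := P.monotone (Nat.succ_le_of_lt h1)
      simp only [Nat.succ_eq_add_one] at this
      omega
  have hsub : (pe b).map σ.toEmbedding ⊆ pe' (σ b) := by
    intro y hy
    obtain ⟨x, hx, rfl⟩ := Finset.mem_map.1 hy
    simp only [Equiv.coe_toEmbedding]
    by_cases hxt : x = top (pe b)
    · have : σ x = top' (pe' (σ b)) := by
        apply P'.injective
        rw [hσ, hxt, hparent]
      rw [this]
      exact R'.top_mem _ hE'
    · obtain ⟨hxr, hxp⟩ := R.eq_pe _ he x hx hxt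
      have h1 := (P.pe_eq_iff b x hbr hxr).1 hxp
      have h2 := (P'.pe_eq_iff (σ b) (σ x) hbr' (hroot x hxr)).2 (by rw [hσ, hσ, h1])
      rw [h2]
      exact R'.mem_pe _ (hroot x hxr)
  rw [Finset.eq_of_subset_of_card_le hsub (by rw [Finset.card_map, hG _ he, hH _ hE'])]
  exact hE'

theorem IsSpiralPosition.isomorphic (P : G.IsSpiralPosition k n₀ d r top pe pos)
    (P' : H.IsSpiralPosition k n₀ d r' top' pe' pos') (hk : 2 ≤ k) (hG : G.IsUniform k)
    (hH : H.IsUniform k) (hE : G.edges.card = H.edges.card) : G.Isomorphic H := by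
  have hbij : ∀ {q : V → ℕ} (_ : Function.Injective q) (hlt : ∀ v, q v < Fintype.card V),
      Function.Bijective (fun v => (⟨q v, hlt v⟩ : Fin (Fintype.card V))) := by
    intro q hq hlt
    rw [Fintype.bijective_iff_injective_and_card]
    exact ⟨fun u v huv => hq (Fin.ext_iff.1 huv), by simp⟩
  let ε := Equiv.ofBijective _ (hbij P.injective P.lt_card)
  let ε' := Equiv.ofBijective _ (hbij P'.injective P'.lt_card)
  let σ : V ≃ V := ε.trans ε'.symm
  have hσ : ∀ v, pos' (σ v) = pos v := fun v =>
    congrArg Fin.val (ε'.apply_symm_apply (ε v))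
  refine ⟨σ, fun e => ⟨fun he => ?_, P.map_mem P' hk hG hH hE σ hσ⟩⟩
  have h1 := P'.map_mem P hk hH hG hE.symm σ.symm (fun v => by
    rw [← hσ, Equiv.apply_symm_apply]) he
  rw [Finset.map_map] at h1
  simpa using h1

end Unique

/-! ### Existence and the equivalence -/

section Main

theorem isomorphic_of_hasSLOrdering {k n n₀ d : ℕ} (hk : 2 ≤ k) (hn₀ : 1 ≤ n₀) (hd : 2 ≤ d)
    {G H : FinHypergraph (Fin n)} (hG : G ∈ supertrees k n n₀) (hH : H ∈ supertrees k n n₀)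
    (hGO : G.HasSLOrdering) (hGD : G.AtMostOneInteriorDegreeGT d) (hHO : H.HasSLOrdering)
    (hHD : H.AtMostOneInteriorDegreeGT d) : G.Isomorphic H := by
  obtain ⟨hGu, hGs, hGc⟩ := hG
  obtain ⟨hHu, hHs, hHc⟩ := hH
  obtain ⟨_, _, _, _, P⟩ := hGO.exists_isSpiralPosition hk hn₀ hd hGu hGs hGc hGD
  obtain ⟨_, _, _, _, P'⟩ := hHO.exists_isSpiralPosition hk hn₀ hd hHu hHs hHc hHD
  refine P.isomorphic P' hk hGu hHu ?_
  have h1 := hGs.card_eq hGu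
  have h2 := hHs.card_eq hHu
  exact Nat.eq_of_mul_eq_mul_right (by omega : 0 < k - 1) (by omega)

theorem exists_hasFaberKrahn {V : Type*} [Fintype V] [DecidableEq V] {C : Set (FinHypergraph V)}
    (hC : C.Nonempty) : ∃ G, HasFaberKrahn C G := by
  have hfin : Finite (FinHypergraph V) :=
    Finite.of_injective FinHypergraph.edges fun _ _ => FinHypergraph.ext
  obtain ⟨G, hG, hmin⟩ := Set.exists_min_image C firstDirichletEigenvalue C.toFinite hC
  exact ⟨G, hG, hmin⟩

end Main

end FinHypergraph

theorem mainTheorem2 (k n n₀ d : ℕ) (hk : 2 ≤ k) (hn₀ : 1 ≤ n₀) (hd : 2 ≤ d) :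
    (∀ G ∈ FinHypergraph.supertrees k n n₀,
      (FinHypergraph.HasFaberKrahn (FinHypergraph.supertreesMinDegree k n n₀ d) G ↔
        G.HasSLOrdering ∧ G.AtMostOneInteriorDegreeGT d)) ∧
    ((FinHypergraph.supertreesMinDegree k n n₀ d).Nonempty →
      ∃ G, FinHypergraph.HasFaberKrahn (FinHypergraph.supertreesMinDegree k n n₀ d) G) ∧
    (∀ G H, FinHypergraph.HasFaberKrahn (FinHypergraph.supertreesMinDegree k n n₀ d) G →
      FinHypergraph.HasFaberKrahn (FinHypergraph.supertreesMinDegree k n n₀ d) H →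
      G.Isomorphic H) := by
  have key : ∀ G, FinHypergraph.HasFaberKrahn (FinHypergraph.supertreesMinDegree k n n₀ d) G →
      G.HasSLOrdering ∧ G.AtMostOneInteriorDegreeGT d := by
    intro G hG
    obtain ⟨c, f, X⟩ := hG.exists_isExtremal hk hn₀ hd
    exact X.hasSLOrdering
  refine ⟨fun G hG => ⟨key G, fun ⟨hO, hD⟩ => ?_⟩, FinHypergraph.exists_hasFaberKrahn,
    fun G H hG hH => ?_⟩
  · have hmem : G ∈ FinHypergraph.supertreesMinDegree k n n₀ d := by
      refine ⟨hG, fun v hv => ?_⟩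
      by_cases hlt : d < G.degree v
      · exact hlt.le
      · exact (hD.2 v hv hlt).ge
    -- A minimizer is itself spiral, hence isomorphic to `G`, which inherits its eigenvalue.
    obtain ⟨H, hH⟩ := FinHypergraph.exists_hasFaberKrahn ⟨G, hmem⟩
    obtain ⟨hHO, hHD⟩ := key H hH
    have hiso := FinHypergraph.isomorphic_of_hasSLOrdering hk hn₀ hd hG hH.1.1 hO hD hHO hHD
    refine ⟨hmem, fun K hK => ?_⟩
    rw [hiso.firstDirichletEigenvalue_eq]
    exact hH.2 K hK
  · obtain ⟨hGO, hGD⟩ := key G hG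
    obtain ⟨hHO, hHD⟩ := key H hH
    exact FinHypergraph.isomorphic_of_hasSLOrdering hk hn₀ hd hG.1.1 hH.1.1 hGO hGD hHO hHD
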